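/- Let $1\le k\le n$ be integers. For $\lambda\in\mathbb R^n$ let $\sigma_j(\lambda)$ be the $j$-th elementary symmetric function and $\Gamma_k=\{\lambda\in\mathbb R^n:\sigma_j(\lambda)>0,\ 1\le j\le k\}$; write $\sigma_k(D^2u)=\sigma_k(\lambda(D^2u))$, where $\lambda(D^2u)$ are the eigenvalues of the Hessian, and call $u$ $k$-admissible if $\lambda(D^2u)\in\Gamma_k$ everywhere in $\Omega$. Let $\Omega\subset\mathbb R^n$ be a bounded $C^3$ domain with outer unit normal $\nu$, let $d(x)=\operatorname{dist}(x,\partial\Omega)$, $\Omega_\mu=\{x\in\Omega: d(x)<\mu\}$, and let $\overline\Omega_\mu$ be the closure of $\Omega_\mu$. Suppose $u\in C^2(\overline\Omega)\cap C^3(\Omega)$ is a $k$-admissible solution of $$\sigma_k(D^2u)=f(x,u)\ \text{ in }\Omega,\qquad u_\nu=\varphi(x,u)\ \text{ on }\partial\Omega,$$ with $|u|\le M_0$ on $\overline\Omega$, where $f\in C^1(\overline\Omega\times[-M_0,M_0])$ and $\varphi\in C^3(\overline\Omega\times[-M_0,M_0])$ satisfy, for positive constants $L_1,L_2$, $$f>0,\qquad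 |f|+|f_x|+|f_z|\le L_1\quad\text{on }\overline\Omega\times[-M_0,M_0],\qquad \|\varphi\|_{C^3(\overline\Omega\times[-M_0,M_0])}\le L_2 .$$ Then there are a constant $\mu_0>0$ depending only on $n,k,\Omega,M_0,L_1,L_2$, a constant $\widetilde M_1=\widetilde M_1(\mu_0)>0$ depending only on $n,k,\mu_0,M_0,L_1$, and a constant $\widetilde M_2>0$ depending only on $n,k,\Omega,\mu_0,M_0,L_1,L_2$, such that $$\sup_{\overline\Omega_{\mu_0}}|Du|\le\max\{\widetilde M_1,\widetilde M_2\}.$$ Here $\widetilde M_1$ is an interior gradient bound: for every $\mu>0$, with $\widetilde M_1(\mu)$ depending only on $n,k,\mu,M_0,L_1$, one has $|Du(x)|\le\widetilde M_1(\mu)$ for all $x\in\Omega$ with $d(x)\ge\mu$. -/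

import Mathlib

/-- `ρ` is a `C^m` local defining function of `Ω` on the open neighbourhood `U` of `x`:
its differential does not vanish on `U`, and inside `U` the set `Ω` is `{ρ < 0}`. -/
structure IsLocalDefiningFunction {n : ℕ} (m : ℕ) (Ω : Set (EuclideanSpace ℝ (Fin n)))
    (x : EuclideanSpace ℝ (Fin n)) (U : Set (EuclideanSpace ℝ (Fin n)))
    (ρ : EuclideanSpace ℝ (Fin n) → ℝ) : Prop where
  isOpen : IsOpen U
  mem : x ∈ U
  contDiffOn : ContDiffOn ℝ m ρ U
  fderiv_ne_zero : ∀ y ∈ U, fderiv ℝ ρ y ≠ 0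
  inter_eq : Ω ∩ U = {y ∈ U | ρ y < 0}

/-- A bounded domain (nonempty connected open set) of `ℝⁿ` with boundary of class `C^m`: near each
boundary point the domain lies on one side of a `C^m` hypersurface. -/
structure IsBoundedCDomain {n : ℕ} (m : ℕ) (Ω : Set (EuclideanSpace ℝ (Fin n))) : Prop where
  isOpen : IsOpen Ω
  isConnected : IsConnected Ω
  isBounded : Bornology.IsBounded Ω
  boundary : ∀ x ∈ frontier Ω, ∃ U ρ, IsLocalDefiningFunction m Ω x U ρ

/-- `v` is the outer unit normal vector of `∂Ω` at the boundary point `x`: the normalized gradient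
of a local defining function (which is negative inside `Ω`). -/
def IsOuterUnitNormal {n : ℕ} (Ω : Set (EuclideanSpace ℝ (Fin n)))
    (x v : EuclideanSpace ℝ (Fin n)) : Prop :=
  x ∈ frontier Ω ∧ ∃ U ρ, IsLocalDefiningFunction 1 Ω x U ρ ∧
    v = ‖gradient ρ x‖⁻¹ • gradient ρ x

/-- The distance `d(x)` to the boundary of `Ω`. -/
noncomputable def boundaryDist {n : ℕ} (Ω : Set (EuclideanSpace ℝ (Fin n)))
    (x : EuclideanSpace ℝ (Fin n)) : ℝ :=
  Metric.infDist x (frontier Ω)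

/-- The boundary strip `Ω_μ = {x ∈ Ω : d(x) < μ}`. -/
def boundaryStrip {n : ℕ} (Ω : Set (EuclideanSpace ℝ (Fin n))) (μ : ℝ) :
    Set (EuclideanSpace ℝ (Fin n)) :=
  {x ∈ Ω | boundaryDist Ω x < μ}

/-- The Hessian matrix `D²u(x)` of second partial derivatives in the standard basis. -/
noncomputable def hessian {n : ℕ} (u : EuclideanSpace ℝ (Fin n) → ℝ)
    (x : EuclideanSpace ℝ (Fin n)) : Matrix (Fin n) (Fin n) ℝ :=
  Matrix.of fun i j =>
    fderiv ℝ (fderiv ℝ u) x (EuclideanSpace.single i 1) (EuclideanSpace.single j 1)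

/-- The eigenvalues of a (symmetric) real matrix, listed with multiplicity: the roots of its
characteristic polynomial. -/
noncomputable def matrixEigenvalues {n : ℕ} (A : Matrix (Fin n) (Fin n) ℝ) : Multiset ℝ :=
  A.charpoly.roots

/-- `σ_k(A)`: the `k`-th elementary symmetric function of the eigenvalues of `A`. -/
noncomputable def sigmaK {n : ℕ} (k : ℕ) (A : Matrix (Fin n) (Fin n) ℝ) : ℝ :=
  (matrixEigenvalues A).esymm k

/-- The cone `Γ_k` of those `λ` with `σ_j(λ) > 0` for `j = 1, …, k`, as a set of
(unordered) lists of numbers. -/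
def gardingCone (k : ℕ) : Set (Multiset ℝ) :=
  {s | ∀ j, 1 ≤ j → j ≤ k → 0 < s.esymm j}

/-- `u` is `k`-admissible on `Ω`: the eigenvalues of `D²u` lie in `Γ_k` at every point. -/
def IsKAdmissible {n : ℕ} (k : ℕ) (Ω : Set (EuclideanSpace ℝ (Fin n)))
    (u : EuclideanSpace ℝ (Fin n) → ℝ) : Prop :=
  ∀ x ∈ Ω, matrixEigenvalues (hessian u x) ∈ gardingCone k

/-- `u ∈ C²(Ω̄) ∩ C³(Ω)` is a `k`-admissible solution of `σ_k(D²u) = f(x,u)` in `Ω`,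
`u_ν = φ(x,u)` on `∂Ω`. The derivative at a boundary point is the one-sided derivative of `u`
within `Ω̄`. -/
structure IsNeumannSolution {n : ℕ} (k : ℕ) (Ω : Set (EuclideanSpace ℝ (Fin n)))
    (f φ : EuclideanSpace ℝ (Fin n) × ℝ → ℝ) (u : EuclideanSpace ℝ (Fin n) → ℝ) : Prop where
  contDiffOn_closure : ContDiffOn ℝ 2 u (closure Ω)
  contDiffOn : ContDiffOn ℝ 3 u Ω
  admissible : IsKAdmissible k Ω u
  equation : ∀ x ∈ Ω, sigmaK k (hessian u x) = f (x, u x)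
  neumann : ∀ x ∈ frontier Ω, ∀ v, IsOuterUnitNormal Ω x v →
    fderivWithin ℝ u (closure Ω) x v = φ (x, u x)

/-- The set `Ω̄ × [-M₀, M₀]`. -/
def dataSet {n : ℕ} (Ω : Set (EuclideanSpace ℝ (Fin n))) (M₀ : ℝ) :
    Set (EuclideanSpace ℝ (Fin n) × ℝ) :=
  closure Ω ×ˢ Set.Icc (-M₀) M₀

/-- `f` is `C¹` and positive on `Ω̄ × [-M₀, M₀]`, and `|f| + |f_x| + |f_z| ≤ L₁` there. -/
structure IsRhsBoundedBy {n : ℕ} (Ω : Set (EuclideanSpace ℝ (Fin n))) (M₀ L₁ : ℝ)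
    (f : EuclideanSpace ℝ (Fin n) × ℝ → ℝ) : Prop where
  contDiffOn : ContDiffOn ℝ 1 f (dataSet Ω M₀)
  pos : ∀ p ∈ dataSet Ω M₀, 0 < f p
  bound : ∀ x ∈ closure Ω, ∀ z ∈ Set.Icc (-M₀) M₀,
    |f (x, z)| + ‖fderivWithin ℝ (fun y => f (y, z)) (closure Ω) x‖
      + |derivWithin (fun t => f (x, t)) (Set.Icc (-M₀) M₀) z| ≤ L₁

/-- `φ` is `C³` on `Ω̄ × [-M₀, M₀]` with `C³` norm at most `L₂`; the norm is the largest of the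
suprema of the derivatives of orders `0, …, 3`. -/
structure IsC3BoundedBy {n : ℕ} (Ω : Set (EuclideanSpace ℝ (Fin n))) (M₀ L₂ : ℝ)
    (φ : EuclideanSpace ℝ (Fin n) × ℝ → ℝ) : Prop where
  contDiffOn : ContDiffOn ℝ 3 φ (dataSet Ω M₀)
  bound : ∀ j ≤ 3, ∀ p ∈ dataSet Ω M₀, ‖iteratedFDerivWithin ℝ j φ (dataSet Ω M₀) p‖ ≤ L₂

/-! The estimate is a maximum principle argument that covers the whole closed domain at once. Let
`N` be a C² field equal to the outer normal on the boundary and `ρ` a C² function with positive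
normal derivative there. Put V = Du - φ(x,u)N and maximize log|V| - (1/2)log(2M₀ - u) - αρ over the
closure of Ω. Subtracting φN makes V tangential on the boundary, by the Neumann condition.

At a boundary maximum, put ξ = V/|V|. Differentiating the Neumann condition in the tangential
direction ξ controls the mixed derivative u_ξν by |Du|, so the logarithmic normal derivative of |V|
is bounded as soon as |V| > 1. A large α then contradicts maximality
(`IsNeumannSolution.norm_le_one_of_boundary_max`).

At an interior maximum, the first order condition in direction ξ makes u_ξξ very negative when |V|
is large. Inside Γ_k this has two consequences for the linearized operator F: F(ξ,ξ) is at least 1/n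
of its trace, and the trace is at least 1. Both follow from Newton's inequality
(`sum_le_mul_sum_weight`, `one_le_sum_of_sum_weight_le`). The second order condition, contracted
with F and combined with the differentiated equation, contains a good term of order |V|² F(ξ,ξ),
which dominates everything else. This bounds |V| (`exists_bound_of_max_conditions`,
`exists_interior_max_bound`).

The interior bound M₁ comes from the same interior lemma with φN replaced by 0 and -αρ replaced by
the logarithm of the cutoff r² - |y - x|². Since the Neumann estimate already holds on the entire
closure, the width of the strip plays no role and μ₀ = 1 serves. -/

/-! ### Newton's inequality and elementary symmetric functions on the Gårding cone -/

open Polynomial in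
theorem Polynomial.Splits.derivative_real {p : ℝ[X]} (hp : p.Splits) :
    (derivative p).Splits := by
  by_cases h0 : derivative p = 0
  · rw [h0]; exact Splits.zero
  rw [splits_iff_card_roots] at hp ⊢
  -- Rolle's theorem: passing to the derivative loses at most one root, counted with multiplicity,
  -- while the degree drops by at least one.
  have h1 := card_roots_le_derivative p
  have h2 := (derivative p).card_roots'
  have h3 : (derivative p).natDegree ≤ p.natDegree - 1 := natDegree_derivative_le p
  omega

-- This is the concavity of log|p|. By induction on the roots: multiplying P by (X - a) turns P'² -
-- PP'' into (x - a)²(P'² - PP'') + P².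
open Polynomial in
theorem Polynomial.Splits.eval_mul_eval_derivative_le {p : ℝ[X]} (hp : p.Splits) (x : ℝ) :
    p.eval x * (derivative (derivative p)).eval x ≤ (derivative p).eval x ^ 2 := by
  have key : ∀ s : Multiset ℝ,
      ((s.map (fun a => X - C a)).prod).eval x *
        (derivative (derivative (s.map (fun a => X - C a)).prod)).eval x ≤
      (derivative (s.map (fun a => X - C a)).prod).eval x ^ 2 := by
    intro s
    induction s using Multiset.induction_on with
    | empty => simp
    | cons a s ih =>
      simp only [Multiset.map_cons, Multiset.prod_cons, derivative_mul, derivative_sub,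
        derivative_X, derivative_C, sub_zero, one_mul, derivative_add, eval_add, eval_mul,
        eval_sub, eval_X, eval_C]
      nlinarith [mul_le_mul_of_nonneg_left ih (sq_nonneg (x - a)),
        sq_nonneg (eval x (s.map (fun a => X - C a)).prod)]
  rw [hp.eq_prod_roots]
  simp only [derivative_C_mul, eval_mul, eval_C]
  nlinarith [mul_le_mul_of_nonneg_left (key p.roots) (sq_nonneg p.leadingCoeff)]

-- The case j = 0 is the preceding inequality at x = 0. Each further step applies the previous case
-- to the derivative, which again has only real roots and has shifted coefficients.
open Polynomial in
theorem Polynomial.Splits.coeff_mul_coeff_le {p : ℝ[X]} (hp : p.Splits) (j : ℕ) :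
    (j + 2) * (p.coeff j * p.coeff (j + 2)) ≤ (j + 1) * p.coeff (j + 1) ^ 2 := by
  induction j generalizing p with
  | zero =>
    have h := hp.eval_mul_eval_derivative_le 0
    simp only [← coeff_zero_eq_eval_zero, coeff_derivative] at h
    norm_num at h ⊢
    nlinarith
  | succ j ih =>
    have h := ih hp.derivative_real
    simp only [coeff_derivative] at h
    push_cast at h ⊢
    have hj : (0:ℝ) < ((j:ℝ) + 1) * (j + 2) := by positivity
    refine le_of_mul_le_mul_left ?_ hj
    ring_nf at h ⊢
    linarith

theorem Multiset.esymm_zero' (s : Multiset ℝ) : s.esymm 0 = 1 := by simp [Multiset.esymm]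

theorem Multiset.esymm_cons (a : ℝ) (s : Multiset ℝ) (j : ℕ) :
    (a ::ₘ s).esymm (j + 1) = s.esymm (j + 1) + a * s.esymm j := by
  simp [Multiset.esymm, Multiset.powersetCard_cons, Multiset.sum_map_mul_left]

open Polynomial in
theorem Multiset.coeff_prod_one_add (s : Multiset ℝ) (j : ℕ) :
    ((s.map (fun a => 1 + C a * X)).prod).coeff j = s.esymm j := by
  induction s using Multiset.induction_on generalizing j with
  | empty => cases j <;> simp [Multiset.esymm, coeff_one, Multiset.powersetCard_zero_right]
  | cons a s ih =>
    rw [Multiset.map_cons, Multiset.prod_cons, add_mul, one_mul, mul_assoc, coeff_add, coeff_C_mul]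
    cases j with
    | zero => simp [ih, Multiset.esymm_zero']
    | succ j => rw [coeff_X_mul, ih, ih, Multiset.esymm_cons]

open Polynomial in
/-- The Newton inequality, without the optimal constant. -/
theorem Multiset.esymm_mul_esymm_le (s : Multiset ℝ) (j : ℕ) :
    s.esymm j * s.esymm (j + 2) ≤ s.esymm (j + 1) ^ 2 := by
  have h : ((s.map (fun a => (1 : ℝ[X]) + C a * X)).prod).Splits := by
    apply Splits.multisetProd
    intro p hp
    obtain ⟨a, -, rfl⟩ := Multiset.mem_map.1 hp
    apply Splits.of_natDegree_le_one
    compute_degree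
  have h2 := h.coeff_mul_coeff_le j
  simp only [Multiset.coeff_prod_one_add] at h2
  have hj : (0:ℝ) ≤ j := Nat.cast_nonneg j
  by_contra! hc
  nlinarith [sq_nonneg (s.esymm (j + 1))]

/-- Removing one entry from an element of `Γ_k` leaves an element of `Γ_{k-1}`. -/
theorem esymm_pos_of_cons_mem_gardingCone {k : ℕ} {a : ℝ} {s : Multiset ℝ}
    (h : a ::ₘ s ∈ gardingCone k) {j : ℕ} (hj : j < k) : 0 < s.esymm j := by
  induction j with
  | zero => rw [Multiset.esymm_zero']; exact one_pos
  | succ j ih =>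
    have h0 := ih (by omega)
    -- If σ_{j+1}(s) ≤ 0, positivity of σ_{j+1} and σ_{j+2} of the full list forces a > 0, aσ_j(s) >
    -- -σ_{j+1}(s) and σ_{j+2}(s) > -aσ_{j+1}(s). Together these give σ_j(s)σ_{j+2}(s) >
    -- σ_{j+1}(s)², against Newton.
    by_contra! hneg
    have h1 := h (j + 1) (by omega) (by omega)
    have h2 := h (j + 2) (by omega) (by omega)
    rw [Multiset.esymm_cons] at h1 h2
    have hN := s.esymm_mul_esymm_le j
    have ha : 0 < a := by
      by_contra! hle
      nlinarith
    nlinarith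

/-- The multiset of the values of `l` at the indices other than `i`. -/
def eraseValues {n : ℕ} (l : Fin n → ℝ) (i : Fin n) : Multiset ℝ :=
  (Finset.univ.erase i).val.map l

theorem cons_eraseValues {n : ℕ} (l : Fin n → ℝ) (i : Fin n) :
    l i ::ₘ eraseValues l i = Finset.univ.val.map l := by
  rw [eraseValues, ← Multiset.map_cons, Finset.erase_val, Multiset.cons_erase]
  simp

theorem esymm_eq_erase_add {n : ℕ} (l : Fin n → ℝ) (i : Fin n) (j : ℕ) :
    (Finset.univ.val.map l).esymm (j + 1) =
      (eraseValues l i).esymm (j + 1) + l i * (eraseValues l i).esymm j := by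
  rw [← cons_eraseValues l i, Multiset.esymm_cons]

-- Compare coefficients in the derivative of the generating polynomial ∏(1 + λ_i X). With j = k - 1
-- this is Euler's identity for σ_k.
open Polynomial in
theorem sum_mul_esymm_eraseValues {n : ℕ} (l : Fin n → ℝ) (j : ℕ) :
    ∑ i, l i * (eraseValues l i).esymm j = (j + 1) * (Finset.univ.val.map l).esymm (j + 1) := by
  have h := congrArg (fun p : ℝ[X] => p.coeff j)
    (Polynomial.derivative_prod_finset (s := Finset.univ) (f := fun i => (1 : ℝ[X]) + C (l i) * X))
  simp only [coeff_derivative, finsetSum_coeff] at h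
  have e1 : ∀ s : Finset (Fin n), (∏ i ∈ s, ((1 : ℝ[X]) + C (l i) * X)) =
      ((s.val.map l).map (fun a => 1 + C a * X)).prod := by
    intro s
    rw [Multiset.map_map]; rfl
  rw [e1, Multiset.coeff_prod_one_add] at h
  rw [mul_comm, h]
  refine Finset.sum_congr rfl fun i _ => ?_
  rw [e1, derivative_add, derivative_C_mul, derivative_X, derivative_one, zero_add, mul_one,
    coeff_mul_C, Multiset.coeff_prod_one_add, mul_comm]
  rfl

theorem sum_esymm_eraseValues {n : ℕ} (l : Fin n → ℝ) (j : ℕ) :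
    ∑ i, (eraseValues l i).esymm j = (n - j) * (Finset.univ.val.map l).esymm j := by
  cases j with
  | zero => simp [Multiset.esymm_zero']
  | succ j =>
    have h : ∀ i, (eraseValues l i).esymm (j + 1) =
        (Finset.univ.val.map l).esymm (j + 1) - l i * (eraseValues l i).esymm j := by
      intro i
      rw [esymm_eq_erase_add l i]; ring
    simp only [h, Finset.sum_sub_distrib, sum_mul_esymm_eraseValues]
    simp
    ring

/-! ### The linearized operator in a direction of negative curvature -/

section

variable {n k : ℕ} {l : Fin n → ℝ}

theorem esymm_eraseValues_pos (hl : Finset.univ.val.map l ∈ gardingCone k) (i : Fin n) {j : ℕ}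
    (hj : j < k) : 0 < (eraseValues l i).esymm j :=
  esymm_pos_of_cons_mem_gardingCone (a := l i) (by rwa [cons_eraseValues]) hj

theorem esymm_pos_of_mem_gardingCone {s : Multiset ℝ} (hl : s ∈ gardingCone k) {j : ℕ}
    (hj : j ≤ k) : 0 < s.esymm j := by
  cases j with
  | zero => rw [Multiset.esymm_zero']; exact one_pos
  | succ j => exact hl (j + 1) (by omega) hj

/-- The two sides differ by λ_i² σ_{j-1}(λ|i) ≥ 0. The sign of λ_i is irrelevant, which is what
allows averaging over all indices afterwards. -/
theorem mul_esymm_eraseValues_le (hl : Finset.univ.val.map l ∈ gardingCone k) (i : Fin n) {j : ℕ}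
    (hj : j < k) : l i * (eraseValues l i).esymm j ≤ l i * (Finset.univ.val.map l).esymm j := by
  cases j with
  | zero => simp [Multiset.esymm_zero']
  | succ j =>
    rw [esymm_eq_erase_add l i]
    nlinarith [mul_nonneg (mul_self_nonneg (l i))
      (esymm_eraseValues_pos hl i (j := j) (by omega)).le]

/-- Average σ_{j+1}(λ|i) = σ_{j+1} - λ_i σ_j(λ|i) ≥ σ_{j+1} - λ_i σ_j with weights p_i. The weights
will be the squared components of a unit vector ξ in an eigenbasis, so that Σ λ_i p_i = u_ξξ. -/
theorem esymm_add_le_sum_weight (hl : Finset.univ.val.map l ∈ gardingCone k) {p : Fin n → ℝ}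
    (hp : ∀ i, 0 ≤ p i) (hp1 : ∑ i, p i = 1) {s : ℝ} (hs : ∑ i, l i * p i ≤ -s)
    {j : ℕ} (hj : j + 1 < k) :
    (Finset.univ.val.map l).esymm (j + 1) + s * (Finset.univ.val.map l).esymm j ≤
      ∑ i, (eraseValues l i).esymm (j + 1) * p i := by
  have h : ∀ i, ((Finset.univ.val.map l).esymm (j + 1) - l i * (Finset.univ.val.map l).esymm j) *
      p i ≤ (eraseValues l i).esymm (j + 1) * p i := by
    intro i
    apply mul_le_mul_of_nonneg_right _ (hp i)
    have := mul_esymm_eraseValues_le hl i (j := j) (by omega)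
    rw [esymm_eq_erase_add l i (j := j)] 
    linarith
  refine le_trans ?_ (Finset.sum_le_sum fun i _ => h i)
  have e : ∑ i, ((Finset.univ.val.map l).esymm (j + 1) -
      l i * (Finset.univ.val.map l).esymm j) * p i =
      (Finset.univ.val.map l).esymm (j + 1) * ∑ i, p i -
      (Finset.univ.val.map l).esymm j * ∑ i, l i * p i := by
    rw [Finset.mul_sum, Finset.mul_sum, ← Finset.sum_sub_distrib]
    exact Finset.sum_congr rfl fun i _ => by ring
  rw [e, hp1]
  nlinarith [esymm_pos_of_mem_gardingCone hl (j := j) (by omega)]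

/-- In a direction in which the Hessian is nonpositive, the linearized operator is comparable to
its trace. -/
theorem sum_le_mul_sum_weight (hk : 1 ≤ k) (hl : Finset.univ.val.map l ∈ gardingCone k)
    {p : Fin n → ℝ} (hp : ∀ i, 0 ≤ p i) (hp1 : ∑ i, p i = 1) (hs : ∑ i, l i * p i ≤ 0) :
    ∑ i, (eraseValues l i).esymm (k - 1) ≤ n * ∑ i, (eraseValues l i).esymm (k - 1) * p i := by
  obtain ⟨j, rfl⟩ : ∃ j, k = j + 1 := ⟨k - 1, by omega⟩
  rw [sum_esymm_eraseValues, Nat.add_sub_cancel]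
  have h0 := esymm_pos_of_mem_gardingCone hl (j := j) (by omega)
  have h1 : (Finset.univ.val.map l).esymm j ≤ ∑ i, (eraseValues l i).esymm j * p i := by
    cases j with
    | zero => simp [Multiset.esymm_zero', hp1]
    | succ j =>
      simpa using esymm_add_le_sum_weight hl hp hp1 (s := 0) (by simpa using hs) (j := j) (by omega)
  have hn : (0:ℝ) ≤ n := Nat.cast_nonneg n
  nlinarith [mul_nonneg (Nat.cast_nonneg j : (0:ℝ) ≤ j) h0.le]

/-- Bounding the weighted sum by the full sum gives σ_{j+1} + nσ_j ≤ (n - j - 1)σ_{j+1}, hence σ_j ≤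
σ_{j+1}. The symmetric functions therefore increase from σ_0 = 1 up to σ_{k-1}, whose multiple (n -
k + 1)σ_{k-1} is the trace of the linearized operator. -/
theorem one_le_esymm_of_sum_weight_le (hn : 0 < n) (hl : Finset.univ.val.map l ∈ gardingCone k)
    {p : Fin n → ℝ} (hp : ∀ i, 0 ≤ p i) (hp1 : ∑ i, p i = 1) (hs : ∑ i, l i * p i ≤ -n)
    {j : ℕ} (hj : j < k) : 1 ≤ (Finset.univ.val.map l).esymm j := by
  induction j with
  | zero => simp [Multiset.esymm_zero']
  | succ j ih =>
    have ih := ih (by omega)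
    have h1 := esymm_add_le_sum_weight hl hp hp1 hs hj
    have h2 : ∑ i, (eraseValues l i).esymm (j + 1) * p i ≤ ∑ i, (eraseValues l i).esymm (j + 1) := by
      refine Finset.sum_le_sum fun i _ => mul_le_of_le_one_right (esymm_eraseValues_pos hl i hj).le ?_
      rw [← hp1]
      exact Finset.single_le_sum (fun i _ => hp i) (Finset.mem_univ i)
    rw [sum_esymm_eraseValues] at h2
    have h0 := esymm_pos_of_mem_gardingCone hl (j := j + 1) (by omega)
    have hn' : (0:ℝ) < n := Nat.cast_pos.2 hn
    push_cast at h2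
    have hj' : (0:ℝ) ≤ j := Nat.cast_nonneg j
    have h3 : n * (Finset.univ.val.map l).esymm j ≤ n * (Finset.univ.val.map l).esymm (j + 1) := by
      nlinarith
    exact ih.trans (le_of_mul_le_mul_left h3 hn')

theorem one_le_sum_of_sum_weight_le (hn : 0 < n) (hk : 1 ≤ k) (hkn : k ≤ n)
    (hl : Finset.univ.val.map l ∈ gardingCone k)
    {p : Fin n → ℝ} (hp : ∀ i, 0 ≤ p i) (hp1 : ∑ i, p i = 1) (hs : ∑ i, l i * p i ≤ -n) :
    1 ≤ ∑ i, (eraseValues l i).esymm (k - 1) := by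
  have h := one_le_esymm_of_sum_weight_le hn hl hp hp1 hs (j := k - 1) (by omega)
  rw [sum_esymm_eraseValues]
  have : (1:ℝ) ≤ (n:ℝ) - ((k - 1 : ℕ):ℝ) := by
    rw [le_sub_iff_add_le]; norm_cast; omega
  nlinarith

end

/-! ### Differentiating σ_k along a curve of symmetric forms -/

-- By Lagrange interpolation at 0, …, N-1 a coefficient is a fixed linear combination of values, so
-- pointwise differentiability of the values passes to the coefficients.
open Polynomial in
theorem hasDerivAt_coeff_of_eval {p : ℝ → ℝ[X]} {q : ℝ[X]} {N : ℕ}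
    (hp : ∀ t, (p t).degree < N) (hq : q.degree < N)
    (h : ∀ x, HasDerivAt (fun t => (p t).eval x) (q.eval x) 0) (m : ℕ) :
    HasDerivAt (fun t => (p t).coeff m) (q.coeff m) 0 := by
  have hinj : Set.InjOn (fun i : ℕ => (i : ℝ)) (Finset.range N) := Nat.cast_injective.injOn
  have key : ∀ r : ℝ[X], r.degree < N → r.coeff m =
      ∑ i ∈ Finset.range N, r.eval (i : ℝ) *
        (Lagrange.basis (Finset.range N) (fun i : ℕ => (i : ℝ)) i).coeff m := by
    intro r hr
    conv_lhs => rw [Lagrange.eq_interpolate (f := r) hinj (by simpa using hr)]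
    simp [Lagrange.interpolate_apply, finsetSum_coeff]
  simp only [key _ (hp _), key _ hq]
  exact HasDerivAt.fun_sum fun i _ => (h i).mul_const _

/-- In the Leibniz formula only the identity permutation contributes to first order: any other
permutation moves at least two indices, so each product rule term keeps a vanishing off-diagonal
factor. -/
theorem hasDerivAt_det_of_diagonal {n : ℕ} {D : ℝ → Matrix (Fin n) (Fin n) ℝ}
    {D' : Matrix (Fin n) (Fin n) ℝ} {d : Fin n → ℝ} (h0 : D 0 = Matrix.diagonal d)
    (h : ∀ i j, HasDerivAt (fun t => D t i j) (D' i j) 0) :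
    HasDerivAt (fun t => (D t).det) (∑ i, D' i i * ∏ j ∈ Finset.univ.erase i, d j) 0 := by
  simp only [Matrix.det_apply]
  have hsum : HasDerivAt (fun t => ∑ σ : Equiv.Perm (Fin n),
      Equiv.Perm.sign σ • ∏ i, D t (σ i) i)
      (∑ σ : Equiv.Perm (Fin n), Equiv.Perm.sign σ •
        ∑ i, (∏ j ∈ Finset.univ.erase i, D 0 (σ j) j) • D' (σ i) i) 0 :=
    HasDerivAt.fun_sum fun σ _ =>
      (HasDerivAt.fun_finsetProd (u := Finset.univ) fun i _ => h (σ i) i).fun_const_smul _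
  convert hsum using 1
  rw [Finset.sum_eq_single (1 : Equiv.Perm (Fin n))]
  · simp [h0, mul_comm]
  · intro σ _ hσ
    rw [Finset.sum_eq_zero, smul_zero]
    intro i _
    obtain ⟨j, hj, hji⟩ : ∃ j, σ j ≠ j ∧ j ≠ i := by
      obtain ⟨j, hj⟩ : ∃ j, σ j ≠ j := by
        by_contra! hc
        exact hσ (Equiv.ext hc)
      by_cases hji : j = i
      · exact ⟨σ j, fun hc => hj (σ.injective hc), fun hc => hj (hc.trans hji.symm)⟩
      · exact ⟨j, hj, hji⟩
    rw [Finset.prod_eq_zero (i := j) (by simp [hji]), zero_smul]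
    rw [h0, Matrix.diagonal_apply_ne _ hj]
  · simp

section

variable {n : ℕ}

/-- The matrix of a bilinear form in the standard basis. -/
noncomputable def formMatrix
    (A : EuclideanSpace ℝ (Fin n) →L[ℝ] EuclideanSpace ℝ (Fin n) →L[ℝ] ℝ) :
    Matrix (Fin n) (Fin n) ℝ :=
  Matrix.of fun i j => A (EuclideanSpace.single i 1) (EuclideanSpace.single j 1)

theorem form_apply_eq_dotProduct
    (A : EuclideanSpace ℝ (Fin n) →L[ℝ] EuclideanSpace ℝ (Fin n) →L[ℝ] ℝ)
    (v w : EuclideanSpace ℝ (Fin n)) :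
    A v w = ∑ i, v i * ((formMatrix A).mulVec w) i := by
  have hv : ∀ v : EuclideanSpace ℝ (Fin n), v = ∑ i, v i • EuclideanSpace.single i (1 : ℝ) := by
    intro v
    conv_lhs => rw [← (EuclideanSpace.basisFun (Fin n) ℝ).sum_repr v]
    simp
  conv_lhs => rw [hv v, hv w]
  simp only [map_sum, map_smul, _root_.sum_apply, _root_.smul_apply,
    smul_eq_mul, Matrix.mulVec, dotProduct, Finset.mul_sum]
  rw [Finset.sum_comm]
  refine Finset.sum_congr rfl fun i _ => Finset.sum_congr rfl fun j _ => ?_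
  simp only [formMatrix, Matrix.of_apply]
  ring

theorem isHermitian_formMatrix
    {A : EuclideanSpace ℝ (Fin n) →L[ℝ] EuclideanSpace ℝ (Fin n) →L[ℝ] ℝ}
    (hA : ∀ v w, A v w = A w v) : (formMatrix A).IsHermitian := by
  ext i j
  simp [formMatrix, hA (EuclideanSpace.single j 1)]

theorem charpoly_formMatrix_eq (b : OrthonormalBasis (Fin n) ℝ (EuclideanSpace ℝ (Fin n)))
    (A : EuclideanSpace ℝ (Fin n) →L[ℝ] EuclideanSpace ℝ (Fin n) →L[ℝ] ℝ) :
    (formMatrix A).charpoly = (Matrix.of fun i j => A (b i) (b j)).charpoly := by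
  set U : Matrix (Fin n) (Fin n) ℝ := Matrix.of fun i j => b j i
  have h1 : U.transpose * U = 1 := by
    ext i j
    have := orthonormal_iff_ite.1 b.orthonormal i j
    rw [PiLp.inner_apply] at this
    simp only [Matrix.mul_apply, Matrix.transpose_apply, U, Matrix.of_apply, Matrix.one_apply]
    rw [← this]
    exact Finset.sum_congr rfl fun k _ => by simp [mul_comm]
  have h2 : U * U.transpose = 1 := mul_eq_one_comm.1 h1
  have h3 : (Matrix.of fun i j => A (b i) (b j)) = U.transpose * (formMatrix A * U) := by
    ext i j
    simp only [Matrix.of_apply]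
    rw [form_apply_eq_dotProduct]
    simp only [Matrix.mul_apply, U, Matrix.transpose_apply, Matrix.of_apply, Matrix.mulVec,
      dotProduct]
  rw [h3, Matrix.charpoly_mul_comm, Matrix.mul_assoc, h2, Matrix.mul_one]

theorem sigmaK_eq_coeff {k : ℕ} (hkn : k ≤ n) {M : Matrix (Fin n) (Fin n) ℝ} (hM : M.IsHermitian) :
    sigmaK k M = (-1) ^ k * M.charpoly.coeff (n - k) := by
  have hd : M.charpoly.natDegree = n := by simp [Matrix.charpoly_natDegree_eq_dim]
  rw [Polynomial.coeff_eq_esymm_roots_of_splits hM.splits_charpoly (by omega), hd,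
    (Matrix.charpoly_monic M).leadingCoeff, one_mul, Nat.sub_sub_self hkn, ← mul_assoc, ← mul_pow]
  simp [sigmaK, matrixEigenvalues]

-- In an orthonormal eigenbasis b_i of A₀ the linearization of σ_k is diagonal with entries
-- σ_{k-1}(λ|i) > 0. The vectors w_i = σ_{k-1}(λ|i)^{1/2} b_i encode it as a sum of squares, so
-- contracting with it means summing over the w_i. Working with a coefficient of the characteristic
-- polynomial, which is independent of the basis, avoids differentiating eigenvalues.
open Polynomial in
theorem exists_linearization {k : ℕ} (hk : 1 ≤ k) (hkn : k ≤ n)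
    {A₀ : EuclideanSpace ℝ (Fin n) →L[ℝ] EuclideanSpace ℝ (Fin n) →L[ℝ] ℝ}
    (hA₀ : ∀ v w, A₀ v w = A₀ w v) (hΓ : matrixEigenvalues (formMatrix A₀) ∈ gardingCone k) :
    ∃ w : Fin n → EuclideanSpace ℝ (Fin n),
      (∀ (A : ℝ → EuclideanSpace ℝ (Fin n) →L[ℝ] EuclideanSpace ℝ (Fin n) →L[ℝ] ℝ)
        (A' : EuclideanSpace ℝ (Fin n) →L[ℝ] EuclideanSpace ℝ (Fin n) →L[ℝ] ℝ),
        HasDerivAt A A' 0 → A 0 = A₀ → (∀ᶠ t in nhds 0, ∀ v w, A t v w = A t w v) →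
        HasDerivAt (fun t => sigmaK k (formMatrix (A t))) (∑ m, A' (w m) (w m)) 0) ∧
      ∑ m, A₀ (w m) (w m) = k * sigmaK k (formMatrix A₀) ∧
      ∀ ξ : EuclideanSpace ℝ (Fin n), ‖ξ‖ = 1 →
        (A₀ ξ ξ ≤ 0 → ∑ m, ‖w m‖ ^ 2 ≤ n * ∑ m, (inner ℝ (w m) ξ) ^ 2) ∧
        (A₀ ξ ξ ≤ -n → 1 ≤ ∑ m, ‖w m‖ ^ 2) := by
  have hM := isHermitian_formMatrix hA₀
  set l := hM.eigenvalues with hl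
  set b := hM.eigenvectorBasis with hb
  have hroots : matrixEigenvalues (formMatrix A₀) = Finset.univ.val.map l := by
    rw [matrixEigenvalues, hM.roots_charpoly_eq_eigenvalues]
    rfl
  rw [hroots] at hΓ
  have hbb : ∀ i j, inner ℝ (b i) (b j) = if i = j then (1:ℝ) else 0 :=
    orthonormal_iff_ite.1 b.orthonormal
  have hdiag : ∀ i j, A₀ (b i) (b j) = if i = j then l i else 0 := by
    intro i j
    rw [form_apply_eq_dotProduct, hM.mulVec_eigenvectorBasis]
    have h1 := hbb i j
    rw [PiLp.inner_apply] at h1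
    simp only [Pi.smul_apply, smul_eq_mul]
    calc ∑ k, b i k * (l j * b j k) = l j * ∑ k, inner ℝ (b i k) (b j k) := by
          rw [Finset.mul_sum]
          exact Finset.sum_congr rfl fun k _ => by simp; ring
      _ = _ := by
          rw [h1]
          split_ifs with h
          · rw [h, mul_one]
          · rw [mul_zero]
  have hquad : ∀ ξ, A₀ ξ ξ = ∑ i, l i * (inner ℝ (b i) ξ) ^ 2 := by
    intro ξ
    conv_lhs => rw [← b.sum_repr' ξ]
    simp only [map_sum, map_smul, _root_.sum_apply, _root_.smul_apply,
      smul_eq_mul, hdiag]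
    simp
    exact Finset.sum_congr rfl fun i _ => by ring
  have hF : ∀ i, 0 < (eraseValues l i).esymm (k - 1) := fun i =>
    esymm_eraseValues_pos hΓ i (by omega)
  set w : Fin n → EuclideanSpace ℝ (Fin n) :=
    fun i => Real.sqrt ((eraseValues l i).esymm (k - 1)) • b i with hw
  have hsq : ∀ i, Real.sqrt ((eraseValues l i).esymm (k - 1)) *
      Real.sqrt ((eraseValues l i).esymm (k - 1)) = (eraseValues l i).esymm (k - 1) :=
    fun i => Real.mul_self_sqrt (hF i).le
  have hww : ∀ (B : EuclideanSpace ℝ (Fin n) →L[ℝ] EuclideanSpace ℝ (Fin n) →L[ℝ] ℝ) i,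
      B (w i) (w i) = (eraseValues l i).esymm (k - 1) * B (b i) (b i) := by
    intro B i
    simp only [hw, map_smul, _root_.smul_apply, smul_eq_mul]
    rw [← mul_assoc, hsq]
  have hnorm : ∀ i, ‖w i‖ ^ 2 = (eraseValues l i).esymm (k - 1) := by
    intro i
    rw [hw]
    simp only
    rw [norm_smul, b.norm_eq_one, mul_one, Real.norm_eq_abs, sq_abs, sq, hsq]
  have hinner : ∀ i ξ, (inner ℝ (w i) ξ) ^ 2 =
      (eraseValues l i).esymm (k - 1) * (inner ℝ (b i) ξ) ^ 2 := by
    intro i ξ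
    rw [hw]
    simp only
    rw [real_inner_smul_left, mul_pow, sq (Real.sqrt _), hsq]
  refine ⟨w, ?_, ?_, ?_⟩
  · intro A A' hA hA0 hsymm
    have hsig : (fun t => sigmaK k (formMatrix (A t))) =ᶠ[nhds 0]
        fun t => (-1) ^ k * (Matrix.of fun i j => A t (b i) (b j)).charpoly.coeff (n - k) := by
      filter_upwards [hsymm] with t ht
      rw [sigmaK_eq_coeff hkn (isHermitian_formMatrix ht), charpoly_formMatrix_eq b]
    refine HasDerivAt.congr_of_eventuallyEq ?_ hsig
    -- Candidate for the t-derivative of the characteristic polynomial at 0: the derivative of det(x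
    -- - A(t)) at a diagonal matrix.
    set q : ℝ[X] := ∑ i, C (-(A' (b i) (b i))) *
      ((eraseValues l i).map fun a => X - C a).prod with hq
    have hcoeff : q.coeff (n - k) = (-1) ^ k * ∑ m, A' (w m) (w m) := by
      rw [hq, finsetSum_coeff, Finset.mul_sum]
      refine Finset.sum_congr rfl fun i _ => ?_
      have hc : Multiset.card (eraseValues l i) = n - 1 := by simp [eraseValues]
      rw [coeff_C_mul, Multiset.prod_X_sub_C_coeff _ (by omega), hc, hww]
      rw [show n - 1 - (n - k) = k - 1 by omega]
      obtain ⟨j, rfl⟩ : ∃ j, k = j + 1 := ⟨k - 1, by omega⟩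
      simp only [Nat.add_sub_cancel, pow_succ]
      ring
    have hderiv := hasDerivAt_coeff_of_eval (N := n + 1)
      (p := fun t => (Matrix.of fun i j => A t (b i) (b j)).charpoly) (q := q) ?_ ?_ ?_ (n - k)
    · rw [hcoeff] at hderiv
      have h2 := hderiv.const_mul ((-1 : ℝ) ^ k)
      rwa [← mul_assoc, ← mul_pow, neg_one_mul, neg_neg, one_pow, one_mul] at h2
    · intro t
      rw [Matrix.charpoly_degree_eq_dim]
      simp only [Fintype.card_fin]
      exact_mod_cast Nat.lt_succ_self n
    · refine (degree_sum_le _ _).trans_lt ?_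
      rw [Finset.sup_lt_iff (by exact_mod_cast WithBot.bot_lt_coe (n + 1))]
      intro i _
      have hc : Multiset.card (eraseValues l i) = n - 1 := by simp [eraseValues]
      refine (degree_mul_le _ _).trans_lt ?_
      refine (add_le_add degree_C_le degree_le_natDegree).trans_lt ?_
      rw [natDegree_multiset_prod_X_sub_C_eq_card, hc, zero_add]
      exact_mod_cast (by omega : n - 1 < n + 1)
    · intro x
      simp only [Matrix.eval_charpoly]
      have h0 := hasDerivAt_det_of_diagonal
        (D := fun t => Matrix.scalar (Fin n) x - Matrix.of fun i j => A t (b i) (b j))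
        (D' := Matrix.of fun i j => -(A' (b i) (b j))) (d := fun i => x - l i) ?_ ?_
      · convert h0 using 1
        rw [hq, eval_finsetSum]
        refine Finset.sum_congr rfl fun i _ => ?_
        rw [eval_mul, eval_C, eval_multiset_prod, eraseValues]
        simp [Multiset.map_map, Finset.prod]
      · ext i j
        simp only [hA0, Matrix.sub_apply, Matrix.of_apply, hdiag, Matrix.scalar_apply,
          Matrix.diagonal_apply]
        split_ifs <;> simp
      · intro i j
        have h1 : HasDerivAt (fun t => A t (b i) (b j)) (A' (b i) (b j)) 0 := by
          have h2 := (hA.clm_apply (hasDerivAt_const (0:ℝ) (b i))).clm_apply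
            (hasDerivAt_const (0:ℝ) (b j))
          simpa using h2
        simpa using h1.const_sub (Matrix.scalar (Fin n) x i j)
  · simp only [hww, hdiag, if_true]
    have h1 := sum_mul_esymm_eraseValues l (k - 1)
    have h2 : ((k - 1 : ℕ) : ℝ) + 1 = k := by exact_mod_cast Nat.sub_add_cancel hk
    rw [h2, Nat.sub_add_cancel hk] at h1
    rw [sigmaK, hroots, ← h1]
    exact Finset.sum_congr rfl fun i _ => mul_comm _ _
  · intro ξ hξ
    have hp1 : ∑ i, (inner ℝ (b i) ξ) ^ 2 = 1 := by rw [b.sum_sq_inner_right, hξ, one_pow]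
    simp only [hnorm, hinner, hquad]
    exact ⟨sum_le_mul_sum_weight hk hΓ (fun i => sq_nonneg _) hp1,
      one_le_sum_of_sum_weight_le (by omega) hk hkn hΓ (fun i => sq_nonneg _) hp1⟩

end

/-! ### Second order calculus along lines -/

open Filter Topology in
/-- `g` is differentiable near `0`, with first derivative `a` and second derivative `b` at `0`. -/
def HasDerivAtTwice {F : Type*} [NormedAddCommGroup F] [NormedSpace ℝ F] (g : ℝ → F) (a b : F) :
    Prop :=
  ∃ g₁ : ℝ → F, (∀ᶠ t in 𝓝 0, HasDerivAt g (g₁ t) t) ∧ g₁ 0 = a ∧ HasDerivAt g₁ b 0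

section

open Filter Topology

variable {F G : Type*} [NormedAddCommGroup F] [NormedSpace ℝ F]
  [NormedAddCommGroup G] [NormedSpace ℝ G]

theorem HasDerivAtTwice.continuousAt {g : ℝ → F} {a b : F} (h : HasDerivAtTwice g a b) :
    ContinuousAt g 0 := by
  obtain ⟨g₁, h1, -, -⟩ := h
  exact h1.self_of_nhds.continuousAt

theorem HasDerivAtTwice.add {g f : ℝ → F} {a b c d : F} (hg : HasDerivAtTwice g a b)
    (hf : HasDerivAtTwice f c d) : HasDerivAtTwice (fun t => g t + f t) (a + c) (b + d) := by
  obtain ⟨g₁, h1, rfl, h3⟩ := hg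
  obtain ⟨f₁, k1, rfl, k3⟩ := hf
  exact ⟨fun t => g₁ t + f₁ t, by filter_upwards [h1, k1] with t ht kt using ht.add kt, rfl,
    h3.add k3⟩

theorem HasDerivAtTwice.clm {g : ℝ → F} {a b : F} (hg : HasDerivAtTwice g a b) (L : F →L[ℝ] G) :
    HasDerivAtTwice (fun t => L (g t)) (L a) (L b) := by
  obtain ⟨g₁, h1, rfl, h3⟩ := hg
  exact ⟨fun t => L (g₁ t),
    by filter_upwards [h1] with t ht using L.hasFDerivAt.comp_hasDerivAt t ht, rfl,
    L.hasFDerivAt.comp_hasDerivAt 0 h3⟩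

theorem HasDerivAtTwice.sub {g f : ℝ → F} {a b c d : F} (hg : HasDerivAtTwice g a b)
    (hf : HasDerivAtTwice f c d) : HasDerivAtTwice (fun t => g t - f t) (a - c) (b - d) := by
  obtain ⟨g₁, h1, rfl, h3⟩ := hg
  obtain ⟨f₁, k1, rfl, k3⟩ := hf
  exact ⟨fun t => g₁ t - f₁ t, by filter_upwards [h1, k1] with t ht kt using ht.sub kt, rfl,
    h3.sub k3⟩

theorem HasDerivAtTwice.prodMk {g : ℝ → F} {f : ℝ → G} {a b : F} {c d : G}
    (hg : HasDerivAtTwice g a b) (hf : HasDerivAtTwice f c d) :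
    HasDerivAtTwice (fun t => (g t, f t)) (a, c) (b, d) := by
  obtain ⟨g₁, h1, rfl, h3⟩ := hg
  obtain ⟨f₁, k1, rfl, k3⟩ := hf
  exact ⟨fun t => (g₁ t, f₁ t), by filter_upwards [h1, k1] with t ht kt using ht.prodMk kt, rfl,
    h3.prodMk k3⟩

theorem hasDerivAtTwice_line (x w : F) : HasDerivAtTwice (fun t : ℝ => x + t • w) w 0 := by
  refine ⟨fun _ => w, Eventually.of_forall fun t => ?_, rfl, hasDerivAt_const _ _⟩
  simpa using ((hasDerivAt_id t).smul_const w).const_add x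

theorem DifferentiableAt.hasDerivAt_line {f : F → G} {x : F} (hf : DifferentiableAt ℝ f x) (w : F) :
    HasDerivAt (fun t : ℝ => f (x + t • w)) (fderiv ℝ f x w) 0 := by
  have h1 : HasDerivAt (fun t : ℝ => x + t • w) w 0 := by
    simpa using ((hasDerivAt_id (0:ℝ)).smul_const w).const_add x
  have h2 : HasFDerivAt f (fderiv ℝ f x) (x + (0:ℝ) • w) := by
    simpa using hf.hasFDerivAt
  exact h2.comp_hasDerivAt (0:ℝ) h1

theorem HasDerivAtTwice.comp_real {g : ℝ → ℝ} {a b : ℝ} (hg : HasDerivAtTwice g a b)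
    {h h' : ℝ → ℝ} {h'' : ℝ} (hh : ∀ᶠ z in 𝓝 (g 0), HasDerivAt h (h' z) z)
    (hh' : HasDerivAt h' h'' (g 0)) :
    HasDerivAtTwice (fun t => h (g t)) (h' (g 0) * a) (h'' * a ^ 2 + h' (g 0) * b) := by
  have hc := hg.continuousAt
  obtain ⟨g₁, h1, rfl, h3⟩ := hg
  refine ⟨fun t => h' (g t) * g₁ t, ?_, rfl, ?_⟩
  · filter_upwards [h1, hc.eventually hh] with t ht kt using kt.comp t ht
  · have h4 : HasDerivAt (fun t => h' (g t) * g₁ t) (h'' * g₁ 0 * g₁ 0 + h' (g 0) * b) 0 :=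
      (hh'.comp 0 h1.self_of_nhds).mul h3
    rwa [show h'' * g₁ 0 ^ 2 + h' (g 0) * b = h'' * g₁ 0 * g₁ 0 + h' (g 0) * b by ring]

/-- Derivatives are taken within `S` because the data are given only on a product with the closed
interval [-M, M], and u may take the endpoint values. -/
theorem HasDerivAtTwice.comp_contDiffOn {S : Set F} {f : F → G} (hf : ContDiffOn ℝ 2 f S)
    (hS : UniqueDiffOn ℝ S) {g : ℝ → F} {a b : F} (hg : HasDerivAtTwice g a b)
    (hgS : ∀ᶠ t in 𝓝 0, g t ∈ S) :
    HasDerivAtTwice (fun t => f (g t)) (fderivWithin ℝ f S (g 0) a)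
      (fderivWithin ℝ (fderivWithin ℝ f S) S (g 0) a a + fderivWithin ℝ f S (g 0) b) := by
  obtain ⟨g₁, h1, rfl, h3⟩ := hg
  have hf1 : ∀ y ∈ S, HasFDerivWithinAt f (fderivWithin ℝ f S y) S y := fun y hy =>
    ((hf.differentiableOn (by norm_num)) y hy).hasFDerivWithinAt
  have hf2 : ∀ y ∈ S, HasFDerivWithinAt (fderivWithin ℝ f S)
      (fderivWithin ℝ (fderivWithin ℝ f S) S y) S y := fun y hy =>
    (((hf.fderivWithin hS (m := 1) (by norm_num)).differentiableOn
      (by norm_num)) y hy).hasFDerivWithinAt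
  refine ⟨fun t => fderivWithin ℝ f S (g t) (g₁ t), ?_, rfl, ?_⟩
  · filter_upwards [h1, hgS, eventually_eventually_nhds.2 hgS] with t ht kt lt using
      (hf1 _ kt).comp_hasDerivAt t ht lt
  · have h4 := (hf2 _ hgS.self_of_nhds).comp_hasDerivAt 0 h1.self_of_nhds hgS
    exact h4.clm_apply h3

theorem hasDerivAtTwice_of_contDiffAt {f : F → G} {x : F} (hf : ContDiffAt ℝ 2 f x) (w : F) :
    HasDerivAtTwice (fun t : ℝ => f (x + t • w)) (fderiv ℝ f x w)
      (fderiv ℝ (fderiv ℝ f) x w w) := by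
  obtain ⟨g₁, h1, h2, h3⟩ := hasDerivAtTwice_line x w
  have hx : x + (0:ℝ) • w = x := by simp
  have hc : Tendsto (fun t : ℝ => x + t • w) (𝓝 0) (𝓝 x) := by
    have := (hasDerivAtTwice_line x w).continuousAt.tendsto
    rwa [hx] at this
  have hline : ∀ t : ℝ, HasDerivAt (fun t : ℝ => x + t • w) w t := fun t => by
    simpa using ((hasDerivAt_id t).smul_const w).const_add x
  have hd : ∀ᶠ y in 𝓝 x, HasFDerivAt f (fderiv ℝ f y) y := by
    filter_upwards [hf.eventually (by norm_num)] with y hy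
    exact (hy.differentiableAt (by norm_num)).hasFDerivAt
  refine ⟨fun t => fderiv ℝ f (x + t • w) w, ?_, by simp, ?_⟩
  · filter_upwards [hc.eventually hd] with t ht using ht.comp_hasDerivAt t (hline t)
  · have h4 : HasFDerivAt (fderiv ℝ f) (fderiv ℝ (fderiv ℝ f) x) (x + (0:ℝ) • w) := by
      rw [hx]
      exact ((hf.fderiv_right (m := 1) (by norm_num)).differentiableAt
        (by norm_num)).hasFDerivAt
    have h5 : HasDerivAt (fun t : ℝ => fderiv ℝ f (x + t • w)) (fderiv ℝ (fderiv ℝ f) x w) 0 :=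
      h4.comp_hasDerivAt (0:ℝ) (hline 0)
    have h6 := h5.clm_apply (hasDerivAt_const (0:ℝ) w)
    rwa [map_zero, add_zero] at h6

/-- If b were positive, the second derivative test would make 0 a local minimum as well. Then g
would be locally constant and b would vanish. -/
theorem HasDerivAtTwice.isLocalMax {g : ℝ → ℝ} {a b : ℝ} (hg : HasDerivAtTwice g a b)
    (hmax : IsLocalMax g 0) : a = 0 ∧ b ≤ 0 := by
  have hc := hg.continuousAt
  obtain ⟨g₁, h1, rfl, h3⟩ := hg
  have ha : g₁ 0 = 0 := hmax.hasDerivAt_eq_zero h1.self_of_nhds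
  refine ⟨ha, ?_⟩
  by_contra! hb
  have hd : deriv g =ᶠ[𝓝 0] g₁ := by filter_upwards [h1] with t ht using ht.deriv
  have hmin : IsLocalMin g 0 := by
    apply isLocalMin_of_deriv_deriv_pos _ _ hc
    · rw [hd.deriv_eq, h3.deriv]; exact hb
    · rw [hd.self_of_nhds, ha]
  have hconst : g =ᶠ[𝓝 0] fun _ => g 0 := by
    filter_upwards [hmin, hmax] with t h4 h5 using le_antisymm h5 h4
  have hg₁ : g₁ =ᶠ[𝓝 0] fun _ => 0 := by
    filter_upwards [h1, eventually_eventually_nhds.2 hconst] with t h4 h5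
    have h6 : HasDerivAt g 0 t := (hasDerivAt_const t (g 0)).congr_of_eventuallyEq h5
    exact h4.unique h6
  have := (h3.congr_of_eventuallyEq hg₁.symm).unique (hasDerivAt_const (0:ℝ) (0:ℝ))
  exact hb.ne' this

end

/-! ### The algebra of the interior maximum conditions -/

theorem mul_sq_le_of_eq_smul_add {E : Type*} [NormedAddCommGroup E] [InnerProductSpace ℝ E]
    {p ξ Y : E} {W B : ℝ} (hp : p = W • ξ + Y) (hY : ‖Y‖ ≤ B) (w : E) :
    1 / 2 * W ^ 2 * (inner ℝ w ξ) ^ 2 ≤ (inner ℝ p w) ^ 2 + B ^ 2 * ‖w‖ ^ 2 := by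
  have h1 : inner ℝ p w = W * inner ℝ w ξ + inner ℝ Y w := by
    rw [hp, inner_add_left, real_inner_smul_left, real_inner_comm]
  have h2 : (inner ℝ Y w) ^ 2 ≤ B ^ 2 * ‖w‖ ^ 2 := by
    rw [← mul_pow, ← sq_abs]
    have := (abs_real_inner_le_norm Y w).trans (mul_le_mul_of_nonneg_right hY (norm_nonneg w))
    gcongr
  rw [h1]
  nlinarith [sq_nonneg (W * inner ℝ w ξ + 2 * inner ℝ Y w)]

/-- The left side will bound u_ξξ from above. Its leading term -hW² is at most -W²/(6M); half of
this absorbs the lower order terms collected in `a`, the other half yields -n. -/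
theorem sub_mul_le_neg_of_large {M B W K h a n : ℝ} (hM : 0 < M) (hB : 0 ≤ B) (hW1 : 1 ≤ W)
    (hK : 1 ≤ K) (ha : a = B / (2 * M) + 1 + B + B + B ^ 2) (hhlow : 1 / (6 * M) ≤ h)
    (hhup : h ≤ 1 / (2 * M)) (hWa : 12 * M * a * K ≤ W) (hWn : 12 * M * n ≤ W) :
    B * (1 + (W + B)) - W * (h * (W - B) - K) ≤ -n := by
  have hW : 0 < W := by linarith
  have h9 : 1 / (6 * M) * W ^ 2 ≤ h * W ^ 2 := mul_le_mul_of_nonneg_right hhlow (sq_nonneg W)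
  have h12 : 0 ≤ B / (2 * M) := by positivity
  have hWK1 : W ≤ W * K := le_mul_of_one_le_right hW.le hK
  have hWK : 1 ≤ W * K := hW1.trans hWK1
  have h10 : W * (h * B) ≤ W * K * (B / (2 * M)) := by
    have h1 : h * B ≤ B / (2 * M) := by
      refine (mul_le_mul_of_nonneg_right hhup hB).trans_eq ?_
      field_simp
    exact (mul_le_mul_of_nonneg_left h1 hW.le).trans (mul_le_mul_of_nonneg_right hWK1 h12)
  have h11 : W * B ≤ W * K * B := mul_le_mul_of_nonneg_right hWK1 hB
  have h12 : B ≤ W * K * B := le_mul_of_one_le_left hB hWK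
  have h13 : B ^ 2 ≤ W * K * B ^ 2 := le_mul_of_one_le_left (sq_nonneg B) hWK
  have h15 : W * K * a ≤ 1 / (12 * M) * W ^ 2 := by
    rw [div_mul_eq_mul_div, one_mul, le_div_iff₀ (by positivity)]
    linarith [mul_le_mul_of_nonneg_left hWa hW.le]
  have h16 : n ≤ 1 / (12 * M) * W ^ 2 := by
    rw [div_mul_eq_mul_div, one_mul, le_div_iff₀ (by positivity)]
    linarith [mul_le_mul_of_nonneg_left hW1 hW.le]
  have h17 : 1 / (6 * M) * W ^ 2 = 2 * (1 / (12 * M) * W ^ 2) := by field_simp; norm_num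
  have e1 : B * (1 + (W + B)) - W * (h * (W - B) - K) =
    B + W * B + B ^ 2 - h * W ^ 2 + W * (h * B) + W * K := by ring
  have e2 : W * K * a = W * K * (B / (2 * M)) + W * K + W * K * B + W * K * B + W * K * B ^ 2 := by
    rw [ha]; ring
  linarith

/-- The coefficient 1/2 of log(2M - u) makes its second derivative contribute 2h²p², against (hp +
e₁)² coming from log|V|. The remainder is ½h²p² + ½(hp - 2e₁)² - 3e₁², so the good term ½h²p²
survives, and e₁ and e₂ together cost at most 4K²N. -/
theorem mul_second_order_le {D Y W h p e₁ e₂ A K N q B : ℝ} (hW : 0 < W)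
    (h1 : ((D - Y) / W - (-(h * p + e₁)) ^ 2) + (2 * h ^ 2 * p ^ 2 + h * A) + e₂ ≤ 0)
    (h3 : e₁ ^ 2 ≤ K ^ 2 * N) (h4 : -(K ^ 2 * N) ≤ e₂) (h5 : Y - q * A ≤ B * (N + p ^ 2)) :
    D - q * A - B * (N + p ^ 2) + W * (1 / 2 * h ^ 2 * p ^ 2) + W * (h * A) -
      W * (4 * K ^ 2 * N) ≤ 0 := by
  have h6 : (D - Y) / W + 1 / 2 * h ^ 2 * p ^ 2 + h * A - 4 * K ^ 2 * N ≤ 0 := by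
    nlinarith [sq_nonneg (h * p - 2 * e₁)]
  have h7 := mul_nonpos_of_nonneg_of_nonpos hW.le h6
  have h8 : W * ((D - Y) / W) = D - Y := mul_div_cancel₀ _ hW.ne'
  linarith

/-- Here T is the trace of the linearized operator, Z its value at ξ, S its value at p = Du, and Q
its contraction with the Hessian. The good term is at least WS/(72M²). Half of it absorbs BS because
W ≥ 144M²B; the rest gives S ≤ 144M²bK²T, where T ≥ 1 absorbs the terms without T. Finally ½W²Z ≤ S
+ B²T and T ≤ nZ turn this into a bound for W² from which T cancels. -/
theorem sq_le_of_sum_inequality {M L B n W K b h q P T Z S Q D : ℝ} (hM : 0 < M) (hL : 0 ≤ L)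
    (hB : 0 ≤ B) (hn0 : 0 < n) (hW1 : 1 ≤ W) (hK : 1 ≤ K)
    (hb : b = 4 + B + L * (2 + B) + B * (n * L)) (hhlow : 1 / (6 * M) ≤ h) (hh0 : 0 < h)
    (hq : q ≤ B) (hpn : P ≤ W + B) (hWB : 144 * M ^ 2 * B ≤ W) (hT1 : 1 ≤ T) (hTZ : T ≤ n * Z)
    (hS0 : 0 ≤ S) (hA0 : 0 ≤ Q) (hAL : Q ≤ n * L) (hD : -(L * (1 + P)) ≤ D)
    (hSZ : 1 / 2 * W ^ 2 * Z ≤ S + B ^ 2 * T)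
    (hsum : D - q * Q - B * (T + S) + W * (1 / 2 * h ^ 2 * S) + W * (h * Q) -
      W * (4 * K ^ 2 * T) ≤ 0) :
    W ^ 2 ≤ 2 * n * (B ^ 2 + 144 * M ^ 2 * b) * K ^ 2 := by
  have hW : 0 < W := by linarith
  have hqQ : q * Q ≤ B * (n * L) := by
    calc q * Q ≤ B * Q := mul_le_mul_of_nonneg_right hq hA0
      _ ≤ _ := mul_le_mul_of_nonneg_left hAL hB
  have hhQ : 0 ≤ W * (h * Q) := by positivity
  have hL2 : L * (1 + P) ≤ W * (L * (2 + B)) := by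
    have h1 : B ≤ W * B := le_mul_of_one_le_left hB hW1
    have h2 : 1 + P ≤ W * (2 + B) := by linarith
    linarith [mul_le_mul_of_nonneg_left h2 hL]
  have hh3 : W * (1 / 2 * h ^ 2 * S) ≥ W * (1 / (72 * M ^ 2) * S) := by
    have : 1 / (72 * M ^ 2) ≤ 1 / 2 * h ^ 2 := by
      have h1 : (1 / (6 * M)) ^ 2 ≤ h ^ 2 := by gcongr
      have h2 : 1 / (72 * M ^ 2) = 1 / 2 * (1 / (6 * M)) ^ 2 := by field_simp; norm_num
      rw [h2]; linarith
    gcongr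
  have hBS : B * S ≤ W * (1 / (144 * M ^ 2) * S) := by
    have h1 : B ≤ W * (1 / (144 * M ^ 2)) := by
      rw [mul_one_div, le_div_iff₀ (by positivity)]; linarith
    calc B * S ≤ W * (1 / (144 * M ^ 2)) * S := mul_le_mul_of_nonneg_right h1 hS0
      _ = _ := by ring
  have h72 : 1 / (72 * M ^ 2) * S = 2 * (1 / (144 * M ^ 2) * S) := by field_simp; ring
  rw [h72] at hh3
  have hK2 : 1 ≤ K ^ 2 := one_le_pow₀ hK
  have hKT : 1 ≤ K ^ 2 * T := one_le_mul_of_one_le_of_one_le hK2 hT1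
  have hb0 : 0 ≤ b := by rw [hb]; positivity
  have hX : 1 / (144 * M ^ 2) * S ≤ b * (K ^ 2 * T) := by
    refine le_of_mul_le_mul_left ?_ hW
    have h1 : B * (n * L) ≤ W * (B * (n * L) * (K ^ 2 * T)) := by
      have h0 : 0 ≤ B * (n * L) := by positivity
      have h5 := le_mul_of_one_le_left h0 (one_le_mul_of_one_le_of_one_le hW1 hKT)
      linarith
    have h2 : W * (L * (2 + B)) ≤ W * (L * (2 + B) * (K ^ 2 * T)) := by
      have h0 : 0 ≤ L * (2 + B) := by positivity
      exact mul_le_mul_of_nonneg_left (le_mul_of_one_le_right h0 hKT) hW.le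
    have h3 : B * T ≤ W * (B * (K ^ 2 * T)) := by
      have h0 : 0 ≤ B * T := by positivity
      have h5 := le_mul_of_one_le_left h0 (one_le_mul_of_one_le_of_one_le hW1 hK2)
      linarith
    have h4 : W * (b * (K ^ 2 * T)) = W * (4 * K ^ 2 * T) + W * (B * (K ^ 2 * T)) +
        W * (L * (2 + B) * (K ^ 2 * T)) + W * (B * (n * L) * (K ^ 2 * T)) := by rw [hb]; ring
    linarith
  have hS2 : S ≤ 144 * M ^ 2 * b * (K ^ 2 * T) := by
    have : S = 144 * M ^ 2 * (1 / (144 * M ^ 2) * S) := by field_simp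
    rw [this]
    have h1 := mul_le_mul_of_nonneg_left hX (by positivity : 0 ≤ 144 * M ^ 2)
    linarith
  have hB2 : B ^ 2 * T ≤ B ^ 2 * (K ^ 2 * T) := by
    have : T ≤ K ^ 2 * T := le_mul_of_one_le_left (by linarith) hK2
    gcongr
  have hfin : W ^ 2 * T ≤ 2 * n * (B ^ 2 + 144 * M ^ 2 * b) * K ^ 2 * T := by
    have h1 : W ^ 2 * T ≤ W ^ 2 * (n * Z) := mul_le_mul_of_nonneg_left hTZ (sq_nonneg W)
    have h2 : n * (1 / 2 * W ^ 2 * Z) ≤ n * ((B ^ 2 + 144 * M ^ 2 * b) * (K ^ 2 * T)) :=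
      mul_le_mul_of_nonneg_left (by linarith) hn0.le
    linarith
  exact le_of_mul_le_mul_right hfin (by linarith)

/-- The first and second order conditions at an interior maximum point of the test function bound
the test function there. -/
theorem exists_bound_of_max_conditions (E : Type*) [NormedAddCommGroup E] [InnerProductSpace ℝ E]
    {n : ℕ} (hn : 0 < n) {M L B : ℝ} (hM : 0 < M) (hL : 0 ≤ L) (hB : 0 ≤ B) :
    ∃ C : ℝ, 0 < C ∧ ∀ (ξ Y p : E) (W v K q : ℝ) (w : Fin n → E) (A : E → E → ℝ)
      (Y₁ Y₂ D e₁ e₂ : E → ℝ), ‖ξ‖ = 1 → ‖Y‖ ≤ B → p = W • ξ + Y → 0 < W → M ≤ v → v ≤ 3 * M →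
      1 ≤ K → |q| ≤ B → (∀ w, |Y₁ w| ≤ B * (‖w‖ + |inner ℝ p w|)) →
      (∀ w, |Y₂ w - q * A w w| ≤ B * (‖w‖ ^ 2 + (inner ℝ p w) ^ 2)) →
      (∀ w, |e₁ w| ≤ K * ‖w‖) → (∀ w, -(K ^ 2 * ‖w‖ ^ 2) ≤ e₂ w) →
      (∀ w, (A w ξ - Y₁ w) / W + 1 / (2 * v) * inner ℝ p w + e₁ w = 0) →
      (∀ w, ((D w - Y₂ w) / W - ((A w ξ - Y₁ w) / W) ^ 2) +
        (1 / (2 * v ^ 2) * (inner ℝ p w) ^ 2 + 1 / (2 * v) * A w w) + e₂ w ≤ 0) →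
      -(L * (1 + ‖p‖)) ≤ ∑ m, D (w m) → 0 ≤ ∑ m, A (w m) (w m) → ∑ m, A (w m) (w m) ≤ n * L →
      (A ξ ξ ≤ 0 → ∑ m, ‖w m‖ ^ 2 ≤ n * ∑ m, (inner ℝ (w m) ξ) ^ 2) →
      (A ξ ξ ≤ -n → 1 ≤ ∑ m, ‖w m‖ ^ 2) → W ≤ C * K := by
  -- `a` collects the lower order terms of the first order condition, `b` those of the summed second
  -- order condition, and `c` is the resulting constant in W² ≤ cK².
  obtain ⟨a, ha⟩ : ∃ a, a = B / (2 * M) + 1 + B + B + B ^ 2 := ⟨_, rfl⟩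
  obtain ⟨b, hb⟩ : ∃ b, b = 4 + B + L * (2 + B) + B * (n * L) := ⟨_, rfl⟩
  obtain ⟨c, hc⟩ : ∃ c, c = 2 * n * (B ^ 2 + 144 * M ^ 2 * b) := ⟨_, rfl⟩
  have ha0 : 0 ≤ a := by rw [ha]; positivity
  have hb0 : 0 ≤ b := by rw [hb]; positivity
  have hc0 : 0 ≤ c := by rw [hc]; positivity
  have hn0 : (0:ℝ) < n := Nat.cast_pos.2 hn
  have hMa := mul_nonneg hM.le ha0
  have hMn := mul_nonneg hM.le hn0.le
  have hMB : 0 ≤ 144 * M ^ 2 * B := by positivity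
  refine ⟨1 + 12 * M * a + 12 * M * n + 144 * M ^ 2 * B + c, by positivity, ?_⟩
  intro ξ Y p W v K q w A Y₁ Y₂ D e₁ e₂ hξ hY hp hW hvM hv3 hK hq hY₁ hY₂ he₁ he₂ hfirst hsecond
    hD hA0 hAL hcmp hone
  by_contra! hWC
  set C := 1 + 12 * M * a + 12 * M * n + 144 * M ^ 2 * B + c with hC
  have hC1 : 1 ≤ C := by linarith
  have hCK : C ≤ C * K := le_mul_of_one_le_right (by linarith) hK
  have hW1 : 1 ≤ W := by linarith
  have hWa : 12 * M * a * K ≤ W := by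
    have : 12 * M * a * K ≤ C * K := mul_le_mul_of_nonneg_right (by linarith) (by linarith)
    linarith
  have hWn : 12 * M * n ≤ W := by linarith
  have hWB : 144 * M ^ 2 * B ≤ W := by linarith
  have hWc : c * K ^ 2 < W ^ 2 := by
    have h1 : (C * K) ^ 2 < W ^ 2 := by
      have : 0 ≤ C * K := by positivity
      gcongr
    have h2 : c ≤ C ^ 2 := le_trans (by linarith) (le_self_pow₀ hC1 two_ne_zero)
    refine (mul_le_mul_of_nonneg_right h2 (sq_nonneg K)).trans_lt ?_
    rwa [← mul_pow]
  have hv : 0 < v := by linarith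
  obtain ⟨h, hh⟩ : ∃ h, h = 1 / (2 * v) := ⟨_, rfl⟩
  have hh2 : 1 / (2 * v ^ 2) = 2 * h ^ 2 := by rw [hh]; field_simp
  rw [← hh] at hfirst
  rw [← hh, hh2] at hsecond
  have hh0 : 0 < h := by rw [hh]; positivity
  have hhlow : 1 / (6 * M) ≤ h := by
    rw [hh]; apply one_div_le_one_div_of_le <;> linarith
  have hhup : h ≤ 1 / (2 * M) := by
    rw [hh]; apply one_div_le_one_div_of_le <;> linarith
  have hYξ : |inner ℝ Y ξ| ≤ B := by
    have := abs_real_inner_le_norm Y ξ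
    rw [hξ, mul_one] at this
    exact this.trans hY
  have hpξ : inner ℝ p ξ = W + inner ℝ Y ξ := by
    rw [hp, inner_add_left, real_inner_smul_left, real_inner_self_eq_norm_sq, hξ]; ring
  have hpn : ‖p‖ ≤ W + B := by
    rw [hp]
    refine (norm_add_le _ _).trans ?_
    rw [norm_smul, hξ, mul_one, Real.norm_eq_abs, abs_of_pos hW]
    linarith
  -- The first order condition in direction ξ itself: u_ξξ is about -hW², which makes both
  -- properties of the linearized operator available.
  have hAξ : A ξ ξ ≤ -n := by
    have h1 : A ξ ξ = Y₁ ξ - W * (h * inner ℝ p ξ + e₁ ξ) := by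
      have := hfirst ξ
      field_simp at this
      linarith
    have h2 := (abs_le.1 (he₁ ξ)).1
    have h3 := (abs_le.1 (hY₁ ξ)).2
    have h4 : |inner ℝ p ξ| ≤ W + B := by
      have := abs_real_inner_le_norm p ξ
      rw [hξ, mul_one] at this
      exact this.trans hpn
    rw [hξ] at h2 h3
    have h5 := (abs_le.1 hYξ).1
    have h6 : Y₁ ξ ≤ B * (1 + (W + B)) := h3.trans (by gcongr)
    have h7 : h * (W - B) - K ≤ h * inner ℝ p ξ + e₁ ξ := by
      rw [hpξ]
      have : h * (W - B) ≤ h * (W + inner ℝ Y ξ) := mul_le_mul_of_nonneg_left (by linarith) hh0.le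
      linarith
    have h8 := mul_le_mul_of_nonneg_left h7 hW.le
    have h9 := sub_mul_le_neg_of_large hM hB hW1 hK ha hhlow hhup hWa hWn
    linarith
  have hT1 := hone hAξ
  have hTZ := hcmp (by linarith)
  set T := ∑ m, ‖w m‖ ^ 2 with hT
  set Z := ∑ m, (inner ℝ (w m) ξ) ^ 2 with hZ
  set S := ∑ m, (inner ℝ p (w m)) ^ 2 with hS
  have hS0 : 0 ≤ S := Finset.sum_nonneg fun _ _ => sq_nonneg _
  set Q := ∑ m, A (w m) (w m) with hQ
  have hSZ : 1 / 2 * W ^ 2 * Z ≤ S + B ^ 2 * T := by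
    rw [hZ, hS, hT, Finset.mul_sum, Finset.mul_sum, ← Finset.sum_add_distrib]
    exact Finset.sum_le_sum fun m _ => mul_sq_le_of_eq_smul_add hp hY (w m)
  have hpoint : ∀ m, D (w m) - q * A (w m) (w m) -
      B * (‖w m‖ ^ 2 + (inner ℝ p (w m)) ^ 2) + W * (1 / 2 * h ^ 2 * (inner ℝ p (w m)) ^ 2) +
      W * (h * A (w m) (w m)) - W * (4 * K ^ 2 * ‖w m‖ ^ 2) ≤ 0 := by
    intro m
    have h1 := hsecond (w m)
    have h2 : (A (w m) ξ - Y₁ (w m)) / W = -(h * inner ℝ p (w m) + e₁ (w m)) := by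
      have := hfirst (w m); linarith
    rw [h2] at h1
    have h3 : e₁ (w m) ^ 2 ≤ K ^ 2 * ‖w m‖ ^ 2 := by
      rw [← mul_pow, ← sq_abs (e₁ (w m))]
      have := he₁ (w m)
      gcongr
    have h4 := he₂ (w m)
    have h5 := (abs_le.1 (hY₂ (w m))).2
    exact mul_second_order_le hW h1 h3 h4 h5
  have hsum := Finset.sum_nonpos fun m (_ : m ∈ Finset.univ) => hpoint m
  simp only [Finset.sum_add_distrib, Finset.sum_sub_distrib, ← Finset.mul_sum] at hsum
  rw [← hT, ← hS, ← hQ] at hsum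
  have := sq_le_of_sum_inequality hM hL hB hn0 hW1 hK hb hhlow hh0 (abs_le.1 hq).2 hpn hWB hT1 hTZ
    hS0 hA0 hAL hD hSZ hsum
  rw [← hc] at this
  linarith

/-! ### The interior maximum of the test function -/

section

open Filter Topology

variable {n : ℕ}

theorem fderiv_three_symm {u : EuclideanSpace ℝ (Fin n) → ℝ} {x : EuclideanSpace ℝ (Fin n)}
    (hu : ContDiffAt ℝ 3 u x) (w ξ : EuclideanSpace ℝ (Fin n)) :
    fderiv ℝ (fderiv ℝ (fderiv ℝ u)) x w w ξ = fderiv ℝ (fderiv ℝ (fderiv ℝ u)) x ξ w w := by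
  have h1 : ContDiffAt ℝ 2 (fderiv ℝ u) x := hu.fderiv_right (m := 2) (by norm_num)
  have h2 : ContDiffAt ℝ 1 (fderiv ℝ (fderiv ℝ u)) x := h1.fderiv_right (m := 1) (by norm_num)
  have h3 : HasFDerivAt (fderiv ℝ (fderiv ℝ u)) (fderiv ℝ (fderiv ℝ (fderiv ℝ u)) x) x :=
    (h2.differentiableAt (by norm_num)).hasFDerivAt
  have hsymm : ∀ᶠ y in 𝓝 x, fderiv ℝ (fderiv ℝ u) y w ξ = fderiv ℝ (fderiv ℝ u) y ξ w := by
    filter_upwards [hu.eventually (by norm_num)] with y hy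
    exact (hy.of_le (by norm_num : (2 : WithTop ℕ∞) ≤ 3)).isSymmSndFDerivAt (by simp) w ξ
  have ha : ∀ a b : EuclideanSpace ℝ (Fin n), HasFDerivAt (fun y => fderiv ℝ (fderiv ℝ u) y a b)
      (((fderiv ℝ (fderiv ℝ (fderiv ℝ u)) x).flip a).flip b) x := by
    intro a b
    have h4 := (h3.clm_apply (hasFDerivAt_const a x)).clm_apply (hasFDerivAt_const b x)
    refine h4.congr_fderiv ?_
    ext c
    simp
  have e1 := (ha w ξ).unique ((ha ξ w).congr_of_eventuallyEq hsymm)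
  have e2 := congrArg (fun T => T w) e1
  simp only [ContinuousLinearMap.flip_apply] at e2
  rw [e2, h1.isSymmSndFDerivAt (by simp) w ξ]

theorem uniqueDiffOn_prod_Icc {Ω : Set (EuclideanSpace ℝ (Fin n))} (hΩ : UniqueDiffOn ℝ Ω) {M : ℝ}
    (hM : 0 < M) :
    UniqueDiffOn ℝ (Ω ×ˢ Set.Icc (-M) M) :=
  hΩ.prod (uniqueDiffOn_Icc (by linarith))

/-- At an interior maximum point of `log |Du - Ψ(x,u)| - log(2M - u)/2 + η`, the vector
`Du - Ψ(x,u)` is bounded in terms of the derivatives of `η`. -/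
theorem exists_interior_max_bound {k : ℕ} (hk : 1 ≤ k) (hkn : k ≤ n) {M L B : ℝ} (hM : 0 < M)
    (hL : 0 ≤ L) (hB : 0 ≤ B) :
    ∃ C : ℝ, 0 < C ∧ ∀ (Ω : Set (EuclideanSpace ℝ (Fin n))) (f : EuclideanSpace ℝ (Fin n) × ℝ → ℝ)
    (u : EuclideanSpace ℝ (Fin n) → ℝ) (Ψ : EuclideanSpace ℝ (Fin n) × ℝ →
    EuclideanSpace ℝ (Fin n)) (η : EuclideanSpace ℝ (Fin n) → ℝ)
      (e₁ e₂ : EuclideanSpace ℝ (Fin n) → ℝ) (x : EuclideanSpace ℝ (Fin n)) (K : ℝ), IsOpen Ω →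
      x ∈ Ω → ContDiffOn ℝ 3 u Ω →
      IsKAdmissible k Ω u → (∀ y ∈ Ω, sigmaK k (hessian u y) = f (y, u y)) →
      (∀ y ∈ Ω, |u y| ≤ M) → DifferentiableOn ℝ f (Ω ×ˢ Set.Icc (-M) M) →
      (∀ p ∈ Ω ×ˢ Set.Icc (-M) M, 0 ≤ f p ∧ f p ≤ L) →
      (∀ p ∈ Ω ×ˢ Set.Icc (-M) M, ∀ v s,
        |fderivWithin ℝ f (Ω ×ˢ Set.Icc (-M) M) p (v, s)| ≤ L * (‖v‖ + |s|)) →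
      ContDiffOn ℝ 2 Ψ (Ω ×ˢ Set.Icc (-M) M) →
      (∀ p ∈ Ω ×ˢ Set.Icc (-M) M, ‖Ψ p‖ ≤ B ∧ ‖fderivWithin ℝ Ψ (Ω ×ˢ Set.Icc (-M) M) p‖ ≤ B ∧
        ‖fderivWithin ℝ (fderivWithin ℝ Ψ (Ω ×ˢ Set.Icc (-M) M)) (Ω ×ˢ Set.Icc (-M) M) p‖ ≤ B) →
      (∀ w, HasDerivAtTwice (fun t : ℝ => η (x + t • w)) (e₁ w) (e₂ w)) →
      (∀ w, |e₁ w| ≤ K * ‖w‖) → (∀ w, -(K ^ 2 * ‖w‖ ^ 2) ≤ e₂ w) → 1 ≤ K →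
      IsLocalMax (fun y => Real.log ‖gradient u y - Ψ (y, u y)‖ - 1 / 2 * Real.log (2 * M - u y) +
        η y) x → ‖gradient u x - Ψ (x, u x)‖ ≤ C * K := by
  -- One constant has to dominate both the derivative bound L of f and the Euler sum kf ≤ kL.
  obtain ⟨C, hC, hmain⟩ := exists_bound_of_max_conditions (EuclideanSpace ℝ (Fin n))
      (by omega : 0 < n) hM
    (show 0 ≤ max L (k * L) by positivity) hB
  refine ⟨C, hC, ?_⟩
  intro Ω f u Ψ η e₁ e₂ x K hΩ hx hu hadm heq huM hf hf01 hf' hΨ hΨB hη he₁ he₂ hK hmax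
  -- The vanishing case is separated because the logarithm there takes only a conventional value.
  by_cases hW0 : ‖gradient u x - Ψ (x, u x)‖ = 0
  · rw [hW0]; positivity
  have hW : 0 < ‖gradient u x - Ψ (x, u x)‖ := lt_of_le_of_ne (norm_nonneg _) (Ne.symm hW0)
  set S : Set (EuclideanSpace ℝ (Fin n) × ℝ) := Ω ×ˢ Set.Icc (-M) M with hSdef
  have hSu : UniqueDiffOn ℝ S := uniqueDiffOn_prod_Icc hΩ.uniqueDiffOn hM
  have hS : ∀ y ∈ Ω, (y, u y) ∈ S := fun y hy => ⟨hy, abs_le.1 (huM y hy)⟩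
  have hux : ContDiffAt ℝ 3 u x := hu.contDiffAt (hΩ.mem_nhds hx)
  have hux2 : ContDiffAt ℝ 2 u x := hux.of_le (by norm_num)
  have hdux : ContDiffAt ℝ 2 (fderiv ℝ u) x := hux.fderiv_right (m := 2) (by norm_num)
  have hlineΩ : ∀ w : EuclideanSpace ℝ (Fin n), ∀ᶠ t : ℝ in 𝓝 0, x + t • w ∈ Ω := by
    intro w
    have hc := (hasDerivAtTwice_line x w).continuousAt
    have : Ω ∈ 𝓝 (x + (0:ℝ) • w) := by simpa using hΩ.mem_nhds hx
    exact hc this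
  have hcurve : ∀ w : EuclideanSpace ℝ (Fin n),
      HasDerivAtTwice (fun t : ℝ => (x + t • w, u (x + t • w)))
      (w, fderiv ℝ u x w) (0, fderiv ℝ (fderiv ℝ u) x w w) := fun w =>
    (hasDerivAtTwice_line x w).prodMk (hasDerivAtTwice_of_contDiffAt hux2 w)
  have hx0 : ∀ w : EuclideanSpace ℝ (Fin n), x + (0:ℝ) • w = x := fun w => by simp
  set p := gradient u x with hp
  have hpw : ∀ w, inner ℝ p w = fderiv ℝ u x w := fun w => inner_gradient_left
  set W := ‖p - Ψ (x, u x)‖ with hWdef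
  -- The direction is frozen at the maximum point: ⟨ξ, V(y)⟩ ≤ |V(y)| with equality at y = x.
  -- Replacing |V| by this linear expression keeps the local maximum at x and leaves no norm to
  -- differentiate.
  set ξ : EuclideanSpace ℝ (Fin n) := W⁻¹ • (p - Ψ (x, u x)) with hξdef
  have hξ : ‖ξ‖ = 1 := by
    rw [hξdef, norm_smul, norm_inv, Real.norm_of_nonneg hW.le, ← hWdef, inv_mul_cancel₀ hW.ne']
  have hWξ : p = W • ξ + Ψ (x, u x) := by
    rw [hξdef, smul_smul, mul_inv_cancel₀ hW.ne', one_smul, sub_add_cancel]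
  obtain ⟨hΨ0, hΨ1, hΨ2⟩ := hΨB _ (hS x hx)
  set Ψ₁ := fderivWithin ℝ Ψ S (x, u x) with hΨ₁
  set Ψ₂ := fderivWithin ℝ (fderivWithin ℝ Ψ S) S (x, u x) with hΨ₂
  set A := fderiv ℝ (fderiv ℝ u) x with hA
  set D := fderiv ℝ (fderiv ℝ (fderiv ℝ u)) x with hD
  set v := 2 * M - u x with hv
  have hux1 := abs_le.1 (huM x hx)
  have hv1 : M ≤ v := by rw [hv]; linarith
  have hv3 : v ≤ 3 * M := by rw [hv]; linarith
  have hv0 : 0 < v := by linarith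
  have hAsymm : ∀ᶠ y in 𝓝 x, ∀ a b, fderiv ℝ (fderiv ℝ u) y a b = fderiv ℝ (fderiv ℝ u) y b a := by
    filter_upwards [hux.eventually (by norm_num)] with y hy
    exact (hy.of_le (by norm_num : (2 : WithTop ℕ∞) ≤ 3)).isSymmSndFDerivAt (by simp)
  obtain ⟨w, hlin, hEuler, hcmp⟩ := exists_linearization hk hkn (A₀ := A) hAsymm.self_of_nhds
    (hadm x hx)
  have hpair : ∀ w : EuclideanSpace ℝ (Fin n),
      ‖((w, fderiv ℝ u x w) : EuclideanSpace ℝ (Fin n) × ℝ)‖ ≤ ‖w‖ + |inner ℝ p w| := by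
    intro w
    rw [Prod.norm_def, hpw]
    exact max_le (le_add_of_nonneg_right (abs_nonneg _)) (le_add_of_nonneg_left (norm_nonneg _))
  have hpair2 : ∀ w : EuclideanSpace ℝ (Fin n),
      ‖((w, fderiv ℝ u x w) : EuclideanSpace ℝ (Fin n) × ℝ)‖ ^ 2 ≤ ‖w‖ ^ 2 + (inner ℝ p w) ^ 2 := by
    intro w
    rw [Prod.norm_def, hpw, ← sq_abs (fderiv ℝ u x w)]
    rcases max_cases ‖w‖ ‖fderiv ℝ u x w‖ with ⟨h, -⟩ | ⟨h, -⟩ <;> simp only [h]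
    · linarith [sq_nonneg |fderiv ℝ u x w|]
    · rw [Real.norm_eq_abs]; linarith [sq_nonneg ‖w‖]
  set Y₁ : EuclideanSpace ℝ (Fin n) → ℝ := fun w => inner ℝ ξ (Ψ₁ (w, fderiv ℝ u x w)) with hY₁
  set Y₂ : EuclideanSpace ℝ (Fin n) → ℝ :=
      fun w => inner ℝ ξ (Ψ₂ (w, fderiv ℝ u x w) (w, fderiv ℝ u x w) +
    Ψ₁ (0, A w w)) with hY₂
  have hfun : ∀ w : EuclideanSpace ℝ (Fin n), HasDerivAtTwice
      (fun t : ℝ => fderiv ℝ u (x + t • w) ξ - inner ℝ ξ (Ψ (x + t • w, u (x + t • w))))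
      (A w ξ - Y₁ w) (D w w ξ - Y₂ w) := by
    intro w
    have h1 := (hasDerivAtTwice_of_contDiffAt hdux w).clm
      ((ContinuousLinearMap.apply ℝ ℝ) ξ : (EuclideanSpace ℝ (Fin n) →L[ℝ] ℝ) →L[ℝ] ℝ)
    have h2 := ((hcurve w).comp_contDiffOn hΨ hSu (by
      filter_upwards [hlineΩ w] with t ht using hS _ ht)).clm (innerSL ℝ ξ)
    have h3 := h1.sub h2
    simp only [hx0] at h3
    exact h3
  have hvalue : ∀ y, fderiv ℝ u y ξ - inner ℝ ξ (Ψ (y, u y)) =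
      inner ℝ ξ (gradient u y - Ψ (y, u y)) := by
    intro y
    rw [inner_sub_right, ← inner_gradient_left (f := u), real_inner_comm]
  have hW0' : inner ℝ ξ (p - Ψ (x, u x)) = W := by
    rw [hξdef, real_inner_smul_left, real_inner_self_eq_norm_sq, ← hWdef, sq, ← mul_assoc,
      inv_mul_cancel₀ hW.ne', one_mul]
  have htest : ∀ w : EuclideanSpace ℝ (Fin n), HasDerivAtTwice (fun t : ℝ =>
      Real.log (fderiv ℝ u (x + t • w) ξ - inner ℝ ξ (Ψ (x + t • w, u (x + t • w)))) +
        (-(1 / 2) * Real.log (2 * M - u (x + t • w))) + η (x + t • w))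
      ((A w ξ - Y₁ w) / W + 1 / (2 * v) * inner ℝ p w + e₁ w)
      (((D w w ξ - Y₂ w) / W - ((A w ξ - Y₁ w) / W) ^ 2) +
        (1 / (2 * v ^ 2) * (inner ℝ p w) ^ 2 + 1 / (2 * v) * A w w) + e₂ w) := by
    intro w
    have h1 := (hfun w).comp_real (h := Real.log) (h' := fun z => z⁻¹) (h'' := -(W ^ 2)⁻¹)
      (by
        simp only [hx0, hvalue]
        rw [hW0']
        filter_upwards [lt_mem_nhds hW] with z hz using Real.hasDerivAt_log hz.ne')
      (by
        simp only [hx0, hvalue]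
        rw [hW0']
        exact hasDerivAt_inv hW.ne')
    have h2 := (hasDerivAtTwice_of_contDiffAt hux2 w).comp_real
      (h := fun z => -(1 / 2) * Real.log (2 * M - z)) (h' := fun z => 1 / 2 * (2 * M - z)⁻¹)
      (h'' := 1 / (2 * v ^ 2))
      (by
        simp only [hx0]
        have : ∀ᶠ z in 𝓝 (u x), z < 2 * M := gt_mem_nhds (by linarith)
        filter_upwards [this] with z hz
        have h3 := (((hasDerivAt_id z).const_sub (2 * M)).log (by simp; linarith)).const_mul
          (-(1 / 2) : ℝ)
        refine h3.congr_deriv ?_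
        simp [div_eq_mul_inv])
      (by
        simp only [hx0]
        have h3 := (((hasDerivAt_id (u x)).const_sub (2 * M)).inv (by simp; linarith)).const_mul
          (1 / 2 : ℝ)
        refine h3.congr_deriv ?_
        simp only [id]
        rw [← hv]
        field_simp)
    have h4 := (h1.add h2).add (hη w)
    simp only [hx0, hvalue] at h4
    rw [hW0', ← hv, ← hA, ← hpw] at h4
    convert h4 using 1
    · simp only [hvalue]
    · field_simp
    · field_simp
      ring
  have hlm : ∀ w : EuclideanSpace ℝ (Fin n), IsLocalMax (fun t : ℝ =>
      Real.log (fderiv ℝ u (x + t • w) ξ - inner ℝ ξ (Ψ (x + t • w, u (x + t • w)))) +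
        (-(1 / 2) * Real.log (2 * M - u (x + t • w))) + η (x + t • w)) 0 := by
    intro w
    have hc : Tendsto (fun t : ℝ => x + t • w) (𝓝 0) (𝓝 x) := by
      have := (hasDerivAtTwice_line x w).continuousAt.tendsto
      rwa [hx0] at this
    have hpos : ∀ᶠ t in 𝓝 (0:ℝ),
        0 < fderiv ℝ u (x + t • w) ξ - inner ℝ ξ (Ψ (x + t • w, u (x + t • w))) := by
      refine (hfun w).continuousAt.eventually (lt_mem_nhds ?_)
      simp only [hx0]
      rw [hvalue, hW0']
      exact hW
    filter_upwards [hc.eventually hmax, hpos] with t ht htpos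
    rw [hx0]
    have e0 : fderiv ℝ u x ξ - inner ℝ ξ (Ψ (x, u x)) = ‖gradient u x - Ψ (x, u x)‖ := by
      rw [hvalue, hW0']
    rw [e0]
    have e1 : Real.log (fderiv ℝ u (x + t • w) ξ - inner ℝ ξ (Ψ (x + t • w, u (x + t • w)))) ≤
        Real.log ‖gradient u (x + t • w) - Ψ (x + t • w, u (x + t • w))‖ := by
      apply Real.log_le_log htpos
      rw [hvalue]
      refine (real_inner_le_norm _ _).trans ?_
      rw [hξ, one_mul]
    linarith
  have hconds := fun w => (htest w).isLocalMax (hlm w)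
  -- The equation differentiated in direction ξ. Symmetry of third derivatives identifies the
  -- contraction of D³u(·,·,ξ) with the derivative of f(x,u) along ξ.
  have hDsum : -(L * (1 + ‖p‖)) ≤ ∑ m, D (w m) (w m) ξ := by
    have hline : HasDerivAt (fun t : ℝ => x + t • ξ) ξ 0 := by
      simpa using ((hasDerivAt_id (0:ℝ)).smul_const ξ).const_add x
    have hc : Tendsto (fun t : ℝ => x + t • ξ) (𝓝 0) (𝓝 x) := by
      have := hline.continuousAt.tendsto
      rwa [hx0] at this
    have h1 : HasDerivAt (fun t : ℝ => fderiv ℝ (fderiv ℝ u) (x + t • ξ)) (D ξ) 0 :=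
      ((hdux.fderiv_right (m := 1) (by norm_num)).differentiableAt
        (by norm_num)).hasDerivAt_line ξ
    have h2 := hlin _ _ h1 (by rw [hx0]) (hc.eventually hAsymm)
    have h3 : HasDerivAt (fun t : ℝ => f (x + t • ξ, u (x + t • ξ)))
        (fderivWithin ℝ f S (x, u x) (ξ, fderiv ℝ u x ξ)) 0 := by
      have h4 : HasDerivAt (fun t : ℝ => (x + t • ξ, u (x + t • ξ))) (ξ, fderiv ℝ u x ξ) 0 :=
        hline.prodMk ((hux.differentiableAt (by norm_num)).hasDerivAt_line ξ)
      have h5 : HasFDerivWithinAt f (fderivWithin ℝ f S (x, u x)) S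
          (x + (0:ℝ) • ξ, u (x + (0:ℝ) • ξ)) := by
        rw [hx0]
        exact (hf _ (hS x hx)).hasFDerivWithinAt
      exact h5.comp_hasDerivAt (0:ℝ) h4 (by
        filter_upwards [hlineΩ ξ] with t ht using hS _ ht)
    have h4 : (fun t : ℝ => sigmaK k (formMatrix (fderiv ℝ (fderiv ℝ u) (x + t • ξ)))) =ᶠ[𝓝 0]
        fun t : ℝ => f (x + t • ξ, u (x + t • ξ)) := by
      filter_upwards [hlineΩ ξ] with t ht using heq _ ht
    have h5 := h2.unique (h3.congr_of_eventuallyEq h4)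
    have h6 : ∑ m, D (w m) (w m) ξ = ∑ m, D ξ (w m) (w m) :=
      Finset.sum_congr rfl fun m _ => fderiv_three_symm hux (w m) ξ
    rw [h6, h5]
    have h7 := (abs_le.1 (hf' _ (hS x hx) ξ (fderiv ℝ u x ξ))).1
    have h8 : |fderiv ℝ u x ξ| ≤ ‖p‖ := by
      rw [← hpw]
      refine (abs_real_inner_le_norm _ _).trans ?_
      rw [hξ, mul_one]
    rw [hξ] at h7
    have h9 : L * (1 + |fderiv ℝ u x ξ|) ≤ L * (1 + ‖p‖) := by gcongr
    linarith
  have hfx := hf01 _ (hS x hx)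
  have hEuler' : ∑ m, A (w m) (w m) = k * f (x, u x) := by
    rw [hEuler, ← heq x hx]; rfl
  -- The number ⟨ξ, Ψ₁(0,1)⟩ is the coefficient with which D²u enters the second derivative of ⟨ξ,
  -- Ψ(y,u)⟩; subtracting that part leaves a term quadratic in (w, u_w).
  refine hmain ξ (Ψ (x, u x)) p W v K (inner ℝ ξ (Ψ₁ (0, 1))) w (fun a b => A a b) Y₁ Y₂
    (fun w => D w w ξ) e₁ e₂ hξ hΨ0 hWξ hW hv1 hv3 hK ?_ ?_ ?_ he₁ he₂ (fun w => (hconds w).1)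
    (fun w => (hconds w).2) ?_ ?_ ?_ (hcmp ξ hξ).1 (hcmp ξ hξ).2
  · refine (abs_real_inner_le_norm _ _).trans ?_
    rw [hξ, one_mul]
    refine (Ψ₁.le_opNorm _).trans ?_
    have : ‖((0, 1) : EuclideanSpace ℝ (Fin n) × ℝ)‖ = 1 := by simp [Prod.norm_def]
    rw [this, mul_one]
    exact hΨ1
  · intro w
    refine (abs_real_inner_le_norm _ _).trans ?_
    rw [hξ, one_mul]
    exact (Ψ₁.le_opNorm _).trans (mul_le_mul hΨ1 (hpair w) (norm_nonneg _) hB)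
  · intro w
    have h1 : Ψ₁ (0, A w w) = A w w • Ψ₁ (0, 1) := by
      rw [← map_smul]; simp
    simp only [hY₂]
    rw [inner_add_right, h1, real_inner_smul_right, mul_comm (inner ℝ ξ _), add_sub_cancel_right]
    refine (abs_real_inner_le_norm _ _).trans ?_
    rw [hξ, one_mul]
    refine (Ψ₂.le_opNorm₂ _ _).trans ?_
    rw [mul_assoc, ← sq]
    exact mul_le_mul hΨ2 (hpair2 w) (sq_nonneg _) hB
  · have : L * (1 + ‖p‖) ≤ max L (k * L) * (1 + ‖p‖) := by gcongr; exact le_max_left _ _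
    linarith
  · rw [hEuler']
    exact mul_nonneg (Nat.cast_nonneg k) hfx.1
  · rw [hEuler']
    have h1 : (1:ℝ) ≤ n := by exact_mod_cast (by omega : 1 ≤ n)
    have h2 : k * f (x, u x) ≤ k * L := mul_le_mul_of_nonneg_left hfx.2 (Nat.cast_nonneg k)
    have h3 : 0 ≤ max L (k * L) := by positivity
    exact (h2.trans (le_max_right _ _)).trans (le_mul_of_one_le_left h3 h1)

end

/-! ### The interior gradient estimate -/

section

open Filter Topology

variable {n : ℕ}

theorem norm_gradient_eq (u : EuclideanSpace ℝ (Fin n) → ℝ) (x : EuclideanSpace ℝ (Fin n)) :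
    ‖gradient u x‖ = ‖fderiv ℝ u x‖ := by
  rw [gradient, LinearIsometryEquiv.norm_map]

theorem ContDiffOn.continuousOn_gradient {u : EuclideanSpace ℝ (Fin n) → ℝ}
    {Ω : Set (EuclideanSpace ℝ (Fin n))} (hΩ : IsOpen Ω)
    (hu : ContDiffOn ℝ 3 u Ω) : ContinuousOn (gradient u) Ω :=
  (InnerProductSpace.toDual ℝ _).symm.continuous.comp_continuousOn
    (hu.continuousOn_fderiv_of_isOpen hΩ (by norm_num))

theorem fderivWithin_closure_eq {F : Type*} [NormedAddCommGroup F] [NormedSpace ℝ F]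
    {g : EuclideanSpace ℝ (Fin n) → F}
    {Ω : Set (EuclideanSpace ℝ (Fin n))} (hΩ : IsOpen Ω) {x : EuclideanSpace ℝ (Fin n)}
    (hx : x ∈ Ω) :
    fderivWithin ℝ g (closure Ω) x = fderiv ℝ g x :=
  fderivWithin_of_mem_nhds (mem_of_superset (hΩ.mem_nhds hx) subset_closure)

theorem prod_Icc_subset_dataSet {Ω : Set (EuclideanSpace ℝ (Fin n))} {M : ℝ} :
    Ω ×ˢ Set.Icc (-M) M ⊆ dataSet Ω M :=
  Set.prod_mono subset_closure subset_rfl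

theorem IsRhsBoundedBy.differentiableOn {Ω : Set (EuclideanSpace ℝ (Fin n))} {M L : ℝ}
    {f : EuclideanSpace ℝ (Fin n) × ℝ → ℝ}
    (hf : IsRhsBoundedBy Ω M L f) : DifferentiableOn ℝ f (Ω ×ˢ Set.Icc (-M) M) :=
  (hf.contDiffOn.differentiableOn (by norm_num)).mono prod_Icc_subset_dataSet

theorem IsRhsBoundedBy.nonneg_and_le {Ω : Set (EuclideanSpace ℝ (Fin n))} {M L : ℝ}
    {f : EuclideanSpace ℝ (Fin n) × ℝ → ℝ}
    (hf : IsRhsBoundedBy Ω M L f) :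
    ∀ p ∈ Ω ×ˢ Set.Icc (-M) M, 0 ≤ f p ∧ f p ≤ L := by
  intro p hp
  have hp' := prod_Icc_subset_dataSet hp
  refine ⟨(hf.pos p hp').le, ?_⟩
  have h1 := hf.bound p.1 hp'.1 p.2 hp'.2
  have h2 := le_abs_self (f (p.1, p.2))
  have h3 := norm_nonneg (fderivWithin ℝ (fun y => f (y, p.2)) (closure Ω) p.1)
  have h4 := abs_nonneg (derivWithin (fun t => f (p.1, t)) (Set.Icc (-M) M) p.2)
  linarith

/-- The hypothesis bounds the two partial derivatives separately; the joint derivative splits into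
them along the factors of the product. -/
theorem IsRhsBoundedBy.abs_fderivWithin_le {Ω : Set (EuclideanSpace ℝ (Fin n))} {M L : ℝ}
    {f : EuclideanSpace ℝ (Fin n) × ℝ → ℝ}
    (hf : IsRhsBoundedBy Ω M L f) (hΩ : IsOpen Ω) (hM : 0 < M) :
    ∀ p ∈ Ω ×ˢ Set.Icc (-M) M, ∀ v s,
      |fderivWithin ℝ f (Ω ×ˢ Set.Icc (-M) M) p (v, s)| ≤ L * (‖v‖ + |s|) := by
  rintro ⟨x, z⟩ hp v s
  set F := fderivWithin ℝ f (Ω ×ˢ Set.Icc (-M) M) (x, z) with hF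
  have hd : HasFDerivWithinAt f F (Ω ×ˢ Set.Icc (-M) M) (x, z) :=
    (hf.differentiableOn _ hp).hasFDerivWithinAt
  have h1 : fderivWithin ℝ (fun y => f (y, z)) (closure Ω) x =
      F.comp (ContinuousLinearMap.inl ℝ (EuclideanSpace ℝ (Fin n)) ℝ) := by
    rw [fderivWithin_closure_eq hΩ hp.1]
    have h2 := hd.comp (f := fun y : EuclideanSpace ℝ (Fin n) => (y, z)) (s := Ω) x
      ((hasFDerivAt_prodMk_left x z).hasFDerivWithinAt) (fun y hy => ⟨hy, hp.2⟩)
    exact (h2.hasFDerivAt (hΩ.mem_nhds hp.1)).fderiv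
  have h2 : derivWithin (fun t => f (x, t)) (Set.Icc (-M) M) z = F (0, 1) := by
    have h3 := hd.comp_hasDerivWithinAt (f := fun t : ℝ => (x, t)) (s := Set.Icc (-M) M) z
      ((hasDerivAt_const z x).prodMk (hasDerivAt_id z)).hasDerivWithinAt (fun t ht => ⟨hp.1, ht⟩)
    exact h3.derivWithin (uniqueDiffOn_Icc (by linarith) z hp.2)
  have hb := hf.bound x (subset_closure hp.1) z hp.2
  rw [h1, h2] at hb
  have h3 : F (v, s) = F.comp (ContinuousLinearMap.inl ℝ (EuclideanSpace ℝ (Fin n)) ℝ) v + s * F (0, 1) := by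
    rw [← smul_eq_mul, ← map_smul]
    simp only [ContinuousLinearMap.comp_apply, ContinuousLinearMap.inl_apply]
    rw [← map_add]
    simp
  have h4 := (F.comp (ContinuousLinearMap.inl ℝ (EuclideanSpace ℝ (Fin n)) ℝ)).le_opNorm v
  have h5 := norm_nonneg (F.comp (ContinuousLinearMap.inl ℝ (EuclideanSpace ℝ (Fin n)) ℝ))
  have h6 := abs_nonneg (F (0, 1))
  have h7 := abs_nonneg (f (x, z))
  rw [h3]
  refine (abs_add_le _ _).trans ?_
  rw [abs_mul, mul_add, mul_comm |s|]
  refine add_le_add (h4.trans ?_) ?_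
  · exact mul_le_mul_of_nonneg_right (by linarith) (norm_nonneg v)
  · exact mul_le_mul_of_nonneg_right (by linarith) (abs_nonneg s)

theorem hasDerivAtTwice_log_sub_norm_sq {x y : EuclideanSpace ℝ (Fin n)} {r : ℝ}
    (h : 0 < r ^ 2 - ‖y - x‖ ^ 2) (w : EuclideanSpace ℝ (Fin n)) :
    HasDerivAtTwice (fun t : ℝ => Real.log (r ^ 2 - ‖y + t • w - x‖ ^ 2))
      (-(2 * inner ℝ (y - x) w) / (r ^ 2 - ‖y - x‖ ^ 2))
      (-(4 * (inner ℝ (y - x) w) ^ 2 / (r ^ 2 - ‖y - x‖ ^ 2) ^ 2) -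
        2 * ‖w‖ ^ 2 / (r ^ 2 - ‖y - x‖ ^ 2)) := by
  have h1 : HasDerivAtTwice (fun t : ℝ => r ^ 2 - ‖y + t • w - x‖ ^ 2)
      (-(2 * inner ℝ (y - x) w)) (-(2 * ‖w‖ ^ 2)) := by
    have e : ∀ t : ℝ, r ^ 2 - ‖y + t • w - x‖ ^ 2 =
        r ^ 2 - ‖y - x‖ ^ 2 + (-(2 * inner ℝ (y - x) w) * t + (-‖w‖ ^ 2) * t ^ 2) := by
      intro t
      rw [show y + t • w - x = (y - x) + t • w by abel, norm_add_sq_real, norm_smul,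
        real_inner_smul_right, Real.norm_eq_abs, mul_pow, sq_abs]
      ring
    simp only [e]
    refine ⟨fun t => -(2 * inner ℝ (y - x) w) + (-‖w‖ ^ 2) * (2 * t),
      Eventually.of_forall fun t => ?_, by simp, ?_⟩
    · have h2 := (((hasDerivAt_id t).const_mul (-(2 * inner ℝ (y - x) w))).add
        (((hasDerivAt_id t).pow 2).const_mul (-‖w‖ ^ 2))).const_add (r ^ 2 - ‖y - x‖ ^ 2)
      refine h2.congr_deriv ?_
      simp
    · have h2 := (((hasDerivAt_id (0:ℝ)).const_mul 2).const_mul (-‖w‖ ^ 2)).const_add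
        (-(2 * inner ℝ (y - x) w))
      refine h2.congr_deriv ?_
      ring
  have h0 : r ^ 2 - ‖y + (0:ℝ) • w - x‖ ^ 2 = r ^ 2 - ‖y - x‖ ^ 2 := by simp
  have h2 := h1.comp_real (h := Real.log) (h' := fun z => z⁻¹)
    (h'' := -((r ^ 2 - ‖y - x‖ ^ 2) ^ 2)⁻¹)
    (by
      rw [h0]
      filter_upwards [lt_mem_nhds h] with z hz using Real.hasDerivAt_log hz.ne')
    (by
      rw [h0]
      exact hasDerivAt_inv h.ne')
  rw [h0] at h2
  convert h2 using 1
  · field_simp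
  · field_simp
    ring

/-- The interior gradient estimate for Hessian equations. -/
theorem exists_interior_gradient_bound {k : ℕ} (hk : 1 ≤ k) (hkn : k ≤ n) {μ M L : ℝ} (hμ : 0 < μ)
    (hM : 0 < M) (hL : 0 ≤ L) :
    ∃ C : ℝ, 0 < C ∧ ∀ (Ω : Set (EuclideanSpace ℝ (Fin n))) (f : EuclideanSpace ℝ (Fin n) × ℝ → ℝ)
    (u : EuclideanSpace ℝ (Fin n) → ℝ) (x : EuclideanSpace ℝ (Fin n)), IsOpen Ω →
      IsRhsBoundedBy Ω M L f → ContDiffOn ℝ 3 u Ω → IsKAdmissible k Ω u →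
      (∀ y ∈ Ω, sigmaK k (hessian u y) = f (y, u y)) → (∀ y ∈ Ω, |u y| ≤ M) →
      Metric.ball x μ ⊆ Ω → ‖fderiv ℝ u x‖ ≤ C := by
  obtain ⟨C, hC, hmain⟩ := exists_interior_max_bound hk hkn hM hL le_rfl
  -- Half the radius puts the closed ball inside Ω, so the test function attains its maximum there.
  obtain ⟨r, hr⟩ : ∃ r, r = μ / 2 := ⟨_, rfl⟩
  have hr0 : 0 < r := by rw [hr]; positivity
  refine ⟨C * (r ^ 2 + 3 * r) / √M * √(3 * M) / r ^ 2, by positivity, ?_⟩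
  intro Ω f u x hΩ hf hu hadm heq huM hball
  rw [← norm_gradient_eq]
  have hsub : Metric.closedBall x r ⊆ Ω :=
    (Metric.closedBall_subset_ball (by rw [hr]; linarith)).trans hball
  have hgrad := hu.continuousOn_gradient hΩ
  have hpos : ∀ y ∈ Ω, M ≤ 2 * M - u y ∧ 2 * M - u y ≤ 3 * M := fun y hy => by
    have := abs_le.1 (huM y hy)
    constructor <;> linarith
  set H : EuclideanSpace ℝ (Fin n) → ℝ :=
      fun y => (r ^ 2 - ‖y - x‖ ^ 2) * ‖gradient u y‖ / √(2 * M - u y) with hH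
  have hHc : ContinuousOn H (Metric.closedBall x r) := by
    refine ContinuousOn.div (ContinuousOn.mul (by fun_prop) (hgrad.mono hsub).norm) ?_ ?_
    · exact (continuousOn_const.sub (hu.continuousOn.mono hsub)).sqrt
    · intro y hy
      have := (hpos y (hsub hy)).1
      exact (Real.sqrt_pos.2 (by linarith)).ne'
  have hxr : x ∈ Metric.closedBall x r := Metric.mem_closedBall_self hr0.le
  by_cases hx0 : ‖gradient u x‖ = 0
  · rw [hx0]; positivity
  have hx0' : 0 < ‖gradient u x‖ := lt_of_le_of_ne (norm_nonneg _) (Ne.symm hx0)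
  obtain ⟨y, hy, hmax⟩ := (isCompact_closedBall x r).exists_isMaxOn ⟨x, hxr⟩ hHc
  have hyΩ := hsub hy
  have hsx : 0 < √(2 * M - u x) := Real.sqrt_pos.2 (by linarith [(hpos x (hsub hxr)).1])
  have hsy : 0 < √(2 * M - u y) := Real.sqrt_pos.2 (by linarith [(hpos y hyΩ).1])
  have hHx : 0 < H x := by
    simp only [hH, sub_self, norm_zero]
    have : 0 < r ^ 2 - 0 ^ 2 := by simpa using pow_pos hr0 2
    positivity
  have hxy : H x ≤ H y := hmax hxr
  have hnum : 0 < (r ^ 2 - ‖y - x‖ ^ 2) * ‖gradient u y‖ := by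
    have := lt_of_lt_of_le hHx hxy
    simpa [hH, div_pos_iff_of_pos_right hsy] using this
  have hζ : 0 < r ^ 2 - ‖y - x‖ ^ 2 := by
    by_contra! h
    exact absurd hnum (not_lt.2 (mul_nonpos_of_nonpos_of_nonneg h (norm_nonneg _)))
  have hgy : 0 < ‖gradient u y‖ :=
    lt_of_le_of_ne (norm_nonneg _) fun h => by rw [← h, mul_zero] at hnum; exact lt_irrefl _ hnum
  set ζ := r ^ 2 - ‖y - x‖ ^ 2 with hζdef
  have hζr : ζ ≤ r ^ 2 := by rw [hζdef]; linarith [sq_nonneg ‖y - x‖]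
  have hyr : ‖y - x‖ ≤ r := by rw [← dist_eq_norm]; exact hy
  have hK0 : 0 ≤ 3 * r / ζ := by positivity
  -- With ζ = r² - |y - x|² the derivatives of log ζ are of size r/ζ and r²/ζ², so K = 1 + 3r/ζ is
  -- admissible. The bound CK is linear in K, hence ζ|Du| ≤ C(r² + 3r) at the maximum point.
  have hbound := hmain Ω f u (fun _ => 0) (fun y => Real.log (r ^ 2 - ‖y - x‖ ^ 2))
    (fun w => -(2 * inner ℝ (y - x) w) / ζ)
    (fun w => -(4 * (inner ℝ (y - x) w) ^ 2 / ζ ^ 2) - 2 * ‖w‖ ^ 2 / ζ) y (1 + 3 * r / ζ) hΩ hyΩ hu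
    hadm heq huM hf.differentiableOn hf.nonneg_and_le (hf.abs_fderivWithin_le hΩ hM)
    contDiffOn_const ?_ (hasDerivAtTwice_log_sub_norm_sq hζ) ?_ ?_ (by linarith) ?_
  · rw [sub_zero] at hbound
    have h1 : ζ * ‖gradient u y‖ ≤ C * (r ^ 2 + 3 * r) := by
      have h2 := mul_le_mul_of_nonneg_left hbound hζ.le
      have h3 : ζ * (C * (1 + 3 * r / ζ)) = C * (ζ + 3 * r) := by field_simp
      rw [h3] at h2
      exact h2.trans (by gcongr)
    have h2 : H y ≤ C * (r ^ 2 + 3 * r) / √M := by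
      simp only [hH]
      gcongr
      exact (hpos y hyΩ).1
    have h3 : r ^ 2 * ‖gradient u x‖ / √(3 * M) ≤ H x := by
      simp only [hH, sub_self, norm_zero]
      have : r ^ 2 - 0 ^ 2 = r ^ 2 := by ring
      rw [this]
      gcongr
      exact (hpos x (hsub hxr)).2
    have h4 := h3.trans (hxy.trans h2)
    rw [div_le_iff₀ (by positivity)] at h4
    rw [le_div_iff₀ (by positivity)]
    linarith
  · intro p hp
    simp
    exact (norm_zero (E := (EuclideanSpace ℝ (Fin n)) × ℝ →L[ℝ]
        (EuclideanSpace ℝ (Fin n)) × ℝ →L[ℝ] (EuclideanSpace ℝ (Fin n)))).le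
  · intro w
    have h1 := abs_real_inner_le_norm (y - x) w
    rw [abs_div, abs_neg, abs_mul, abs_of_pos hζ, abs_two, div_le_iff₀ hζ]
    have h2 : (1 + 3 * r / ζ) * ‖w‖ * ζ = ζ * ‖w‖ + 3 * (r * ‖w‖) := by field_simp
    rw [h2]
    have h3 : ‖y - x‖ * ‖w‖ ≤ r * ‖w‖ := by gcongr
    have h4 := mul_nonneg hζ.le (norm_nonneg w)
    have h5 := mul_nonneg hr0.le (norm_nonneg w)
    linarith
  · intro w
    have h1 : (inner ℝ (y - x) w) ^ 2 ≤ r ^ 2 * ‖w‖ ^ 2 := by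
      rw [← mul_pow, ← sq_abs]
      have h2 := (abs_real_inner_le_norm (y - x) w).trans
        (mul_le_mul_of_nonneg_right hyr (norm_nonneg w))
      gcongr
    have h2 : 4 * (inner ℝ (y - x) w) ^ 2 / ζ ^ 2 ≤ 4 * (r ^ 2 * ‖w‖ ^ 2) / ζ ^ 2 := by gcongr
    have h3 : 2 * ‖w‖ ^ 2 / ζ ≤ 2 * (r ^ 2 * ‖w‖ ^ 2) / ζ ^ 2 := by
      rw [div_le_div_iff₀ hζ (by positivity)]
      have := mul_le_mul_of_nonneg_left hζr (by positivity : 0 ≤ 2 * ‖w‖ ^ 2 * ζ)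
      nlinarith
    have h4 : (1 + 3 * r / ζ) ^ 2 * ‖w‖ ^ 2 =
        ‖w‖ ^ 2 + 6 * r / ζ * ‖w‖ ^ 2 + 9 * (r ^ 2 * ‖w‖ ^ 2) / ζ ^ 2 := by
      field_simp; ring
    have h5 : 0 ≤ 6 * r / ζ * ‖w‖ ^ 2 := by positivity
    have h6 : 4 * (r ^ 2 * ‖w‖ ^ 2) / ζ ^ 2 + 2 * (r ^ 2 * ‖w‖ ^ 2) / ζ ^ 2 ≤
        9 * (r ^ 2 * ‖w‖ ^ 2) / ζ ^ 2 := by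
      rw [← add_div]
      have : 0 ≤ r ^ 2 * ‖w‖ ^ 2 := by positivity
      gcongr
      linarith
    rw [h4]
    linarith [sq_nonneg ‖w‖]
  · simp only [sub_zero]
    have hΩy := hΩ.mem_nhds hyΩ
    have hg : ∀ᶠ z in 𝓝 y, 0 < ‖gradient u z‖ :=
      (hgrad.continuousAt hΩy).norm.eventually (lt_mem_nhds hgy)
    have hz : ∀ᶠ z in 𝓝 y, 0 < r ^ 2 - ‖z - x‖ ^ 2 :=
      (by fun_prop : Continuous fun z => r ^ 2 - ‖z - x‖ ^ 2).continuousAt.eventually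
        (lt_mem_nhds hζ)
    have hlog : ∀ z ∈ Ω, 0 < ‖gradient u z‖ → 0 < r ^ 2 - ‖z - x‖ ^ 2 →
        Real.log ‖gradient u z‖ - 1 / 2 * Real.log (2 * M - u z) +
          Real.log (r ^ 2 - ‖z - x‖ ^ 2) = Real.log (H z) := by
      intro z hzΩ h1 h2
      have h3 := (hpos z hzΩ).1
      have h4 : 0 < √(2 * M - u z) := Real.sqrt_pos.2 (by linarith)
      simp only [hH]
      rw [Real.log_div (mul_pos h2 h1).ne' h4.ne', Real.log_mul h2.ne' h1.ne',
        Real.log_sqrt (by linarith)]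
      ring
    filter_upwards [hg, hz, hΩy] with z h1 h2 h3
    rw [hlog z h3 h1 h2, hlog y hyΩ hgy hζ]
    have h4 : 0 < √(2 * M - u z) := Real.sqrt_pos.2 (by linarith [(hpos z h3).1])
    apply Real.log_le_log
    · simp only [hH]; positivity
    · apply hmax
      rw [mem_closedBall_iff_norm]
      nlinarith [norm_nonneg (z - x)]

end

/-! ### Local defining functions, tangent directions and normals -/

section

open Filter Topology

variable {n : ℕ}

theorem IsLocalDefiningFunction.of_le {m m' : ℕ} {Ω : Set (EuclideanSpace ℝ (Fin n))}
    {x : EuclideanSpace ℝ (Fin n)} {U : Set (EuclideanSpace ℝ (Fin n))}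
    {ρ : EuclideanSpace ℝ (Fin n) → ℝ}
    (h : IsLocalDefiningFunction m Ω x U ρ) (hm : m' ≤ m) :
    IsLocalDefiningFunction m' Ω x U ρ :=
  ⟨h.isOpen, h.mem, h.contDiffOn.of_le (by exact_mod_cast hm), h.fderiv_ne_zero, h.inter_eq⟩

theorem IsLocalDefiningFunction.of_mem {m : ℕ} {Ω : Set (EuclideanSpace ℝ (Fin n))}
    {x y : EuclideanSpace ℝ (Fin n)} {U : Set (EuclideanSpace ℝ (Fin n))}
    {ρ : EuclideanSpace ℝ (Fin n) → ℝ}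
    (h : IsLocalDefiningFunction m Ω x U ρ) (hy : y ∈ U) : IsLocalDefiningFunction m Ω y U ρ :=
  ⟨h.isOpen, hy, h.contDiffOn, h.fderiv_ne_zero, h.inter_eq⟩

theorem IsLocalDefiningFunction.mem_iff {m : ℕ} {Ω : Set (EuclideanSpace ℝ (Fin n))}
    {x y : EuclideanSpace ℝ (Fin n)} {U : Set (EuclideanSpace ℝ (Fin n))}
    {ρ : EuclideanSpace ℝ (Fin n) → ℝ}
    (h : IsLocalDefiningFunction m Ω x U ρ) (hy : y ∈ U) : y ∈ Ω ↔ ρ y < 0 := by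
  have := Set.ext_iff.1 h.inter_eq y
  simpa [hy] using this

theorem IsLocalDefiningFunction.contDiffAt {m : ℕ} {Ω : Set (EuclideanSpace ℝ (Fin n))}
    {x y : EuclideanSpace ℝ (Fin n)} {U : Set (EuclideanSpace ℝ (Fin n))}
    {ρ : EuclideanSpace ℝ (Fin n) → ℝ} (h : IsLocalDefiningFunction m Ω x U ρ) (hy : y ∈ U) :
    ContDiffAt ℝ m ρ y :=
  h.contDiffOn.contDiffAt (h.isOpen.mem_nhds hy)

section

variable {Ω : Set (EuclideanSpace ℝ (Fin n))} {x : EuclideanSpace ℝ (Fin n)}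
  {U : Set (EuclideanSpace ℝ (Fin n))} {ρ : EuclideanSpace ℝ (Fin n) → ℝ}

theorem IsLocalDefiningFunction.differentiableAt (h : IsLocalDefiningFunction 1 Ω x U ρ) :
    DifferentiableAt ℝ ρ x :=
  (h.contDiffAt h.mem).differentiableAt (by norm_num)

theorem IsLocalDefiningFunction.eq_zero (h : IsLocalDefiningFunction 1 Ω x U ρ) (hΩ : IsOpen Ω)
    (hx : x ∈ frontier Ω) : ρ x = 0 := by
  have hxΩ : x ∉ Ω := by
    rw [hΩ.frontier_eq] at hx
    exact hx.2
  apply le_antisymm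
  · by_contra! hpos
    have h1 : ∀ᶠ y in 𝓝 x, 0 < ρ y ∧ y ∈ U :=
      (h.differentiableAt.continuousAt.eventually (lt_mem_nhds hpos)).and (h.isOpen.mem_nhds h.mem)
    obtain ⟨y, hyΩ, hy1, hyU⟩ :=
      ((mem_closure_iff_frequently.1 (frontier_subset_closure hx)).and_eventually h1).exists
    exact absurd ((h.mem_iff hyU).1 hyΩ) (not_lt.2 hy1.le)
  · by_contra! hneg
    exact hxΩ ((h.mem_iff h.mem).2 hneg)

/-- A direction of negative derivative makes ρ negative at once, hence points into Ω. -/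
theorem IsLocalDefiningFunction.eventually_mem (h : IsLocalDefiningFunction 1 Ω x U ρ)
    (h0 : ρ x = 0) {v : EuclideanSpace ℝ (Fin n)} (hv : fderiv ℝ ρ x v < 0) :
    ∀ᶠ t : ℝ in 𝓝[>] 0, x + t • v ∈ Ω := by
  have h1 := h.differentiableAt.hasDerivAt_line v
  have h2 := (hasDerivAt_iff_tendsto_slope.1 h1).mono_left
    (nhdsWithin_mono 0 fun t (ht : 0 < t) => ht.ne')
  have hc : Tendsto (fun t : ℝ => x + t • v) (𝓝 0) (𝓝 x) := by
    have := (hasDerivAtTwice_line x v).continuousAt.tendsto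
    simpa using this
  have h3 := h2.eventually (gt_mem_nhds hv)
  filter_upwards [h3, self_mem_nhdsWithin,
    (hc.mono_left nhdsWithin_le_nhds).eventually (h.isOpen.mem_nhds h.mem)] with t ht ht0 htU
  rw [h.mem_iff htU]
  have ht0' : (0:ℝ) < t := ht0
  rw [slope_def_field, div_lt_iff₀ (by linarith)] at ht
  simpa [h0] using ht

theorem IsLocalDefiningFunction.exists_neg (h : IsLocalDefiningFunction 1 Ω x U ρ) :
    ∃ v, fderiv ℝ ρ x v < 0 := by
  obtain ⟨v, hv⟩ : ∃ v, fderiv ℝ ρ x v ≠ 0 := by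
    by_contra! hc
    exact h.fderiv_ne_zero x h.mem (ContinuousLinearMap.ext hc)
  rcases lt_or_gt_of_ne hv with hv | hv
  · exact ⟨v, hv⟩
  · exact ⟨-v, by rw [map_neg]; linarith⟩

theorem IsLocalDefiningFunction.mem_frontier (h : IsLocalDefiningFunction 1 Ω x U ρ)
    (hΩ : IsOpen Ω) (h0 : ρ x = 0) : x ∈ frontier Ω := by
  rw [hΩ.frontier_eq]
  refine ⟨?_, fun hx => ?_⟩
  · obtain ⟨v, hv⟩ := h.exists_neg
    have hc : Tendsto (fun t : ℝ => x + t • v) (𝓝[>] 0) (𝓝 x) := by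
      have := (hasDerivAtTwice_line x v).continuousAt.tendsto
      simpa using this.mono_left nhdsWithin_le_nhds
    exact mem_closure_of_tendsto hc (h.eventually_mem h0 hv)
  · rw [h.mem_iff h.mem, h0] at hx
    exact lt_irrefl _ hx

/-- The tangent cone contains the nonempty open half-space on which the differential of ρ is
negative, and an open set spans everything. -/
theorem IsLocalDefiningFunction.uniqueDiffWithinAt (h : IsLocalDefiningFunction 1 Ω x U ρ)
    (hΩ : IsOpen Ω) (hx : x ∈ frontier Ω) : UniqueDiffWithinAt ℝ (closure Ω) x := by
  have h0 := h.eq_zero hΩ hx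
  refine ⟨?_, subset_closure (frontier_subset_closure hx)⟩
  have hsub : {v | fderiv ℝ ρ x v < 0} ⊆ tangentConeAt ℝ (closure Ω) x := by
    intro v hv
    refine mem_tangentConeAt_of_add_smul_mem (l := 𝓝[>] (0:ℝ)) (c := id) ?_ ?_
    · exact tendsto_id.mono_left (nhdsWithin_mono _ fun t (ht : 0 < t) => ht.ne')
    · filter_upwards [h.eventually_mem h0 hv] with t ht using subset_closure ht
  have hopen : IsOpen {v | fderiv ℝ ρ x v < 0} :=
    isOpen_lt (fderiv ℝ ρ x).continuous continuous_const
  have htop : Submodule.span ℝ (tangentConeAt ℝ (closure Ω) x) = ⊤ := by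
    apply Submodule.eq_top_of_nonempty_interior'
    obtain ⟨v, hv⟩ := h.exists_neg
    exact ⟨v, mem_interior.2 ⟨_, hsub.trans Submodule.subset_span, hopen, hv⟩⟩
  rw [htop]
  exact dense_univ

theorem IsLocalDefiningFunction.gradient_ne_zero (h : IsLocalDefiningFunction 1 Ω x U ρ) :
    gradient ρ x ≠ 0 := by
  intro h0
  have := norm_gradient_eq ρ x
  rw [h0, norm_zero] at this
  exact h.fderiv_ne_zero x h.mem (norm_eq_zero.1 this.symm)

/-- If the unit normals a and b differed, the direction b - a would enter Ω according to ρ and leave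
it according to ρ'. -/
theorem IsLocalDefiningFunction.normal_unique {U' : Set (EuclideanSpace ℝ (Fin n))}
    {ρ' : EuclideanSpace ℝ (Fin n) → ℝ}
    (h : IsLocalDefiningFunction 1 Ω x U ρ) (h' : IsLocalDefiningFunction 1 Ω x U' ρ')
    (hΩ : IsOpen Ω) (hx : x ∈ frontier Ω) :
    ‖gradient ρ x‖⁻¹ • gradient ρ x = ‖gradient ρ' x‖⁻¹ • gradient ρ' x := by
  set a := ‖gradient ρ x‖⁻¹ • gradient ρ x with ha
  set b := ‖gradient ρ' x‖⁻¹ • gradient ρ' x with hb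
  have hg : 0 < ‖gradient ρ x‖ := norm_pos_iff.2 h.gradient_ne_zero
  have hg' : 0 < ‖gradient ρ' x‖ := norm_pos_iff.2 h'.gradient_ne_zero
  have ha1 : ‖a‖ = 1 := by rw [ha, norm_smul, norm_inv, norm_norm, inv_mul_cancel₀ hg.ne']
  have hb1 : ‖b‖ = 1 := by rw [hb, norm_smul, norm_inv, norm_norm, inv_mul_cancel₀ hg'.ne']
  have ha2 : ∀ v, fderiv ℝ ρ x v = ‖gradient ρ x‖ * inner ℝ a v := by
    intro v
    rw [← inner_gradient_left, ha, real_inner_smul_left, ← mul_assoc, mul_inv_cancel₀ hg.ne',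
      one_mul]
  have hb2 : ∀ v, fderiv ℝ ρ' x v = ‖gradient ρ' x‖ * inner ℝ b v := by
    intro v
    rw [← inner_gradient_left, hb, real_inner_smul_left, ← mul_assoc, mul_inv_cancel₀ hg'.ne',
      one_mul]
  by_contra hne
  have hlt : inner ℝ a b < 1 := by
    refine lt_of_le_of_ne ?_ ?_
    · have := real_inner_le_norm a b
      rwa [ha1, hb1, mul_one] at this
    · intro heq
      exact hne ((inner_eq_one_iff_of_norm_eq_one ha1 hb1).1 heq)
  have h1 : fderiv ℝ ρ x (b - a) < 0 := by
    rw [ha2, inner_sub_right, real_inner_self_eq_norm_sq, ha1]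
    nlinarith
  have h2 : fderiv ℝ ρ' x (-(b - a)) < 0 := by
    rw [hb2, inner_neg_right, inner_sub_right, real_inner_self_eq_norm_sq, hb1,
      real_inner_comm]
    nlinarith
  have h3 := h.eventually_mem (h.eq_zero hΩ hx) h1
  have hd := h'.differentiableAt.hasDerivAt_line (b - a)
  have h4 : ∀ᶠ t : ℝ in 𝓝[>] 0, 0 < ρ' (x + t • (b - a)) := by
    have h5 := (hasDerivAt_iff_tendsto_slope.1 hd).mono_left
      (nhdsWithin_mono 0 fun t (ht : 0 < t) => ht.ne')
    rw [map_neg, neg_lt_zero] at h2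
    filter_upwards [h5.eventually (lt_mem_nhds h2), self_mem_nhdsWithin] with t ht ht0
    have ht0' : (0:ℝ) < t := ht0
    rw [slope_def_field, lt_div_iff₀ (by linarith)] at ht
    simpa [h'.eq_zero hΩ hx] using ht
  have hc : Tendsto (fun t : ℝ => x + t • (b - a)) (𝓝[>] 0) (𝓝 x) := by
    have := (hasDerivAtTwice_line x (b - a)).continuousAt.tendsto
    simpa using this.mono_left nhdsWithin_le_nhds
  obtain ⟨t, ht1, ht2, ht3⟩ :=
    (h3.and (h4.and (hc.eventually (h'.isOpen.mem_nhds h'.mem)))).exists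
  exact absurd ((h'.mem_iff ht3).1 ht1) (not_lt.2 ht2.le)

/-- Tangent vectors of the boundary are velocities of curves in the boundary. -/
theorem IsLocalDefiningFunction.exists_curve (h : IsLocalDefiningFunction 1 Ω x U ρ)
    (hΩ : IsOpen Ω) (hx : x ∈ frontier Ω) {ξ : EuclideanSpace ℝ (Fin n)} (hξ : fderiv ℝ ρ x ξ = 0) :
    ∃ γ : ℝ → EuclideanSpace ℝ (Fin n), γ 0 = x ∧ HasDerivAt γ ξ 0 ∧ ∀ᶠ t in 𝓝 0,
    γ t ∈ frontier Ω := by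
  have hs : HasStrictFDerivAt ρ (fderiv ℝ ρ x) x :=
    (h.contDiffAt h.mem).hasStrictFDerivAt (by norm_num)
  have hr : (fderiv ℝ ρ x).range = ⊤ := by
    obtain ⟨v, hv⟩ := h.exists_neg
    refine LinearMap.range_eq_top.2 fun c => ⟨(c / fderiv ℝ ρ x v) • v, ?_⟩
    simp [hv.ne]
  set ξ' : (fderiv ℝ ρ x).ker := ⟨ξ, hξ⟩
  have h0 := h.eq_zero hΩ hx
  -- The implicit function parametrizes the zero level of ρ near x by the kernel of its
  -- differential; nearby zeros of ρ are boundary points.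
  set φ := hs.implicitFunction ρ (fderiv ℝ ρ x) hr with hφ
  have hline : HasDerivAt (fun t : ℝ => t • ξ') ξ' 0 := by
    simpa using (hasDerivAt_id (0:ℝ)).smul_const ξ'
  have hd : HasFDerivAt (φ (ρ x)) (fderiv ℝ ρ x).ker.subtypeL ((0:ℝ) • ξ') := by
    rw [zero_smul]
    exact (hs.to_implicitFunction hr).hasFDerivAt
  have hγ0 : φ (ρ x) ((0:ℝ) • ξ') = x := by
    rw [zero_smul]
    exact hs.implicitFunction_apply_image hr
  have hγ : HasDerivAt (fun t : ℝ => φ (ρ x) (t • ξ')) ξ 0 := by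
    have := HasFDerivAt.comp_hasDerivAt (l' := (fderiv ℝ ρ x).ker.subtypeL) (0:ℝ) hd hline
    exact this
  refine ⟨fun t => φ (ρ x) (t • ξ'), hγ0, hγ, ?_⟩
  have hc : Tendsto (fun t : ℝ => φ (ρ x) (t • ξ')) (𝓝 0) (𝓝 x) := by
    have := hγ.continuousAt.tendsto
    rwa [hγ0] at this
  have hc2 : Tendsto (fun t : ℝ => (ρ x, t • ξ')) (𝓝 0) (𝓝 (ρ x, 0)) := by
    have := hline.continuousAt.tendsto
    rw [zero_smul] at this
    exact tendsto_const_nhds.prodMk_nhds this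
  filter_upwards [hc.eventually (h.isOpen.mem_nhds h.mem),
    hc2.eventually (hs.map_implicitFunction_eq hr)] with t ht1 ht2
  exact (h.of_mem ht1).mem_frontier hΩ (ht2.trans h0)

end

theorem IsBoundedCDomain.uniqueDiffOn_closure {Ω : Set (EuclideanSpace ℝ (Fin n))}
    (hΩ : IsBoundedCDomain 3 Ω) :
    UniqueDiffOn ℝ (closure Ω) := by
  intro x hx
  by_cases hxΩ : x ∈ Ω
  · exact (hΩ.isOpen.uniqueDiffWithinAt hxΩ).mono subset_closure
  · have hf : x ∈ frontier Ω := by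
      rw [hΩ.isOpen.frontier_eq]; exact ⟨hx, hxΩ⟩
    obtain ⟨U, ρ, h⟩ := hΩ.boundary x hf
    exact (h.of_le (by norm_num)).uniqueDiffWithinAt hΩ.isOpen hf

end

/-! ### A global defining function and an extended normal field -/

section

open Filter Topology

variable {n : ℕ}

theorem contDiff_mul_of_tsupport_subset {χ ρ : EuclideanSpace ℝ (Fin n) → ℝ}
    {U : Set (EuclideanSpace ℝ (Fin n))} {m : WithTop ℕ∞}
    (hχ : ContDiff ℝ m χ) (hU : IsOpen U) (hρ : ContDiffOn ℝ m ρ U) (hs : tsupport χ ⊆ U) :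
    ContDiff ℝ m fun y => χ y * ρ y := by
  rw [contDiff_iff_contDiffAt]
  intro y
  by_cases hy : y ∈ U
  · exact hχ.contDiffAt.mul (hρ.contDiffAt (hU.mem_nhds hy))
  · have h0 : (fun y => χ y * ρ y) =ᶠ[𝓝 y] fun _ => 0 := by
      filter_upwards [notMem_tsupport_iff_eventuallyEq.1 fun h => hy (hs h)] with z hz
      rw [hz]; simp
    exact contDiffAt_const.congr_of_eventuallyEq h0

/-- Glue finitely many local defining functions with bumps. On the boundary each ρ_x vanishes, so
the gradient of χ_x ρ_x is χ_x times that of ρ_x, a nonnegative multiple of the common outer normal.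
No partition of unity is needed, only one positive summand at each boundary point. -/
theorem IsBoundedCDomain.exists_defining_function {Ω : Set (EuclideanSpace ℝ (Fin n))}
    (hΩ : IsBoundedCDomain 3 Ω) :
    ∃ ρ : EuclideanSpace ℝ (Fin n) → ℝ, ContDiff ℝ 3 ρ ∧ ∀ y ∈ frontier Ω, gradient ρ y ≠ 0 ∧
      IsOuterUnitNormal Ω y (‖gradient ρ y‖⁻¹ • gradient ρ y) := by
  have hK : IsCompact (frontier Ω) :=
    Metric.isCompact_of_isClosed_isBounded isClosed_frontier
      (hΩ.isBounded.closure.subset frontier_subset_closure)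
  choose! U ρ hρ using hΩ.boundary
  have hr : ∀ x ∈ frontier Ω, ∃ r : ℝ, 0 < r ∧ Metric.closedBall x (2 * r) ⊆ U x := by
    intro x hx
    obtain ⟨ε, hε, hsub⟩ := Metric.isOpen_iff.1 (hρ x hx).isOpen x (hρ x hx).mem
    refine ⟨ε / 4, by positivity, (Metric.closedBall_subset_ball ?_).trans hsub⟩
    linarith
  choose! r hr0 hrU using hr
  obtain ⟨t, htK, ht⟩ := hK.elim_nhds_subcover (fun x => Metric.ball x (r x))
    fun x hx => Metric.ball_mem_nhds x (hr0 x hx)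
  have hbump : ∀ x ∈ frontier Ω, ∃ χ : EuclideanSpace ℝ (Fin n) → ℝ,
      ContDiff ℝ 3 χ ∧ (∀ y, 0 ≤ χ y) ∧
      (∀ y ∈ Metric.ball x (r x), χ y = 1) ∧ tsupport χ ⊆ U x := by
    intro x hx
    let b : ContDiffBump x := ⟨r x, 2 * r x, hr0 x hx, by linarith [hr0 x hx]⟩
    refine ⟨b, b.contDiff, fun y => b.nonneg, fun y hy => ?_, ?_⟩
    · exact b.one_of_mem_closedBall (Metric.ball_subset_closedBall hy)
    · rw [b.tsupport_eq]
      exact hrU x hx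
  choose! χ hχ hχ0 hχ1 hχU using hbump
  refine ⟨fun y => ∑ x ∈ t, χ x y * ρ x y, ?_, ?_⟩
  · exact ContDiff.sum fun x hx => contDiff_mul_of_tsupport_subset (hχ x (htK x hx))
      (hρ x (htK x hx)).isOpen (hρ x (htK x hx)).contDiffOn (hχU x (htK x hx))
  · intro y hy
    have hloc := (hρ y hy).of_le (by norm_num : 1 ≤ 3)
    set ν := ‖gradient (ρ y) y‖⁻¹ • gradient (ρ y) y with hν
    have hterm : ∀ x ∈ t, HasGradientAt (fun z => χ x z * ρ x z)
        ((χ x y * ‖gradient (ρ x) y‖) • ν) y := by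
      intro x hx
      have hxK := htK x hx
      by_cases hyU : y ∈ U x
      · have h1 := ((hρ x hxK).of_le (by norm_num : 1 ≤ 3)).of_mem hyU
        have h2 : HasFDerivAt (fun z => χ x z * ρ x z)
            (χ x y • fderiv ℝ (ρ x) y + ρ x y • fderiv ℝ (χ x) y) y :=
          (((hχ x hxK).differentiable (by norm_num)) y).hasFDerivAt.mul
            h1.differentiableAt.hasFDerivAt
        rw [h1.eq_zero hΩ.isOpen hy, zero_smul, add_zero] at h2
        rw [hasGradientAt_iff_hasFDerivAt]
        refine h2.congr_fderiv ?_
        ext v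
        rw [hν, hloc.normal_unique h1 hΩ.isOpen hy]
        have hg : ‖gradient (ρ x) y‖ ≠ 0 := norm_ne_zero_iff.2 h1.gradient_ne_zero
        rw [smul_smul, mul_assoc, mul_inv_cancel₀ hg, mul_one]
        simp
      · have h0 : χ x =ᶠ[𝓝 y] 0 := notMem_tsupport_iff_eventuallyEq.1 fun h => hyU (hχU x hxK h)
        rw [h0.self_of_nhds]
        simp only [Pi.zero_apply, zero_mul, zero_smul]
        rw [hasGradientAt_iff_hasFDerivAt, map_zero]
        refine (hasFDerivAt_const (0:ℝ) y).congr_of_eventuallyEq ?_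
        filter_upwards [h0] with z hz
        rw [hz]; simp
    have hgrad : gradient (fun z => ∑ x ∈ t, χ x z * ρ x z) y =
        (∑ x ∈ t, χ x y * ‖gradient (ρ x) y‖) • ν := by
      apply HasGradientAt.gradient
      rw [hasGradientAt_iff_hasFDerivAt, Finset.sum_smul, map_sum]
      exact HasFDerivAt.fun_sum fun x hx => (hasGradientAt_iff_hasFDerivAt.1 (hterm x hx))
    have hθ : 0 < ∑ x ∈ t, χ x y * ‖gradient (ρ x) y‖ := by
      obtain ⟨x, hx, hyx⟩ := Set.mem_iUnion₂.1 (ht hy)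
      refine Finset.sum_pos' (fun z hz => mul_nonneg (hχ0 z (htK z hz) y) (norm_nonneg _))
        ⟨x, hx, ?_⟩
      rw [hχ1 x (htK x hx) y hyx, one_mul, norm_pos_iff]
      refine (((hρ x (htK x hx)).of_le (by norm_num : 1 ≤ 3)).of_mem ?_).gradient_ne_zero
      exact hrU x (htK x hx) (Metric.ball_subset_closedBall.trans
        (Metric.closedBall_subset_closedBall (by linarith [hr0 x (htK x hx)])) hyx)
    have hg : 0 < ‖gradient (ρ y) y‖ := norm_pos_iff.2 hloc.gradient_ne_zero
    have hν1 : ‖ν‖ = 1 := by rw [hν, norm_smul, norm_inv, norm_norm, inv_mul_cancel₀ hg.ne']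
    rw [hgrad]
    refine ⟨smul_ne_zero hθ.ne' (norm_ne_zero_iff.1 (by rw [hν1]; exact one_ne_zero)), ?_⟩
    rw [norm_smul, hν1, mul_one, Real.norm_of_nonneg hθ.le, smul_smul, inv_mul_cancel₀ hθ.ne',
      one_smul]
    exact ⟨hy, U y, ρ y, hloc, hν⟩

/-- Used to normalize the gradient on the whole space: the cutoff vanishes for s ≤ c/2 and equals 1
for s ≥ c, which removes the singularity at zeros of the gradient. -/
theorem exists_contDiff_inv_sqrt {c : ℝ} (hc : 0 < c) :
    ∃ m : ℝ → ℝ, ContDiff ℝ 2 m ∧ ∀ s, c ≤ s → m s = (√s)⁻¹ := by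
  refine ⟨fun s => Real.smoothTransition (2 * s / c - 1) * (√s)⁻¹, ?_, ?_⟩
  · rw [contDiff_iff_contDiffAt]
    intro s
    have hT : ContDiffAt ℝ 2 (fun s : ℝ => Real.smoothTransition (2 * s / c - 1)) s := by
      have h1 : ContDiff ℝ 2 Real.smoothTransition := Real.smoothTransition.contDiff (n := 2)
      exact (h1.comp (by fun_prop : ContDiff ℝ 2 fun s : ℝ => 2 * s / c - 1)).contDiffAt
    by_cases hs : 0 < s
    · have h2 : ContDiffAt ℝ 2 (fun s : ℝ => (√s)⁻¹) s :=
        (Real.contDiffAt_sqrt hs.ne').inv (Real.sqrt_pos.2 hs).ne'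
      exact hT.mul h2
    · have h0 : (fun s => Real.smoothTransition (2 * s / c - 1) * (√s)⁻¹) =ᶠ[𝓝 s]
          fun _ => 0 := by
        filter_upwards [gt_mem_nhds (show s < c / 2 by linarith)] with z hz
        rw [Real.smoothTransition.zero_of_nonpos, zero_mul]
        rw [sub_nonpos, div_le_one hc]
        linarith
      exact contDiffAt_const.congr_of_eventuallyEq h0
  · intro s hs
    simp only
    rw [Real.smoothTransition.one_of_one_le, one_mul]
    rw [le_sub_iff_add_le, le_div_iff₀ hc]
    linarith

theorem IsBoundedCDomain.exists_normal_field {Ω : Set (EuclideanSpace ℝ (Fin n))}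
    (hΩ : IsBoundedCDomain 3 Ω) :
    ∃ (ρ : EuclideanSpace ℝ (Fin n) → ℝ) (N : EuclideanSpace ℝ (Fin n) → EuclideanSpace ℝ (Fin n))
    (c : ℝ), ContDiff ℝ 2 ρ ∧ ContDiff ℝ 2 N ∧ 0 < c ∧
      ∀ y ∈ frontier Ω, IsOuterUnitNormal Ω y (N y) ∧ ‖N y‖ = 1 ∧ c ≤ fderiv ℝ ρ y (N y) := by
  obtain ⟨ρ, hρ, hν⟩ := hΩ.exists_defining_function
  have hK : IsCompact (frontier Ω) :=
    Metric.isCompact_of_isClosed_isBounded isClosed_frontier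
      (hΩ.isBounded.closure.subset frontier_subset_closure)
  have hg : ContDiff ℝ 2 (gradient ρ) := by
    have h1 : ContDiff ℝ 2 (fderiv ℝ ρ) := hρ.fderiv_right (m := 2) (by norm_num)
    exact (InnerProductSpace.toDual ℝ (EuclideanSpace ℝ (Fin n))).symm.contDiff.comp h1
  obtain ⟨c, hc, hcK⟩ : ∃ c : ℝ, 0 < c ∧ ∀ y ∈ frontier Ω, c ≤ ‖gradient ρ y‖ := by
    rcases (frontier Ω).eq_empty_or_nonempty with he | hne
    · exact ⟨1, one_pos, by simp [he]⟩
    · obtain ⟨y, hy, hmin⟩ := hK.exists_isMinOn hne hg.continuous.norm.continuousOn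
      exact ⟨‖gradient ρ y‖, norm_pos_iff.2 (hν y hy).1, fun z hz => hmin hz⟩
  obtain ⟨m, hm, hms⟩ := exists_contDiff_inv_sqrt (pow_pos hc 2)
  refine ⟨ρ, fun y => m (‖gradient ρ y‖ ^ 2) • gradient ρ y, c, hρ.of_le (by norm_num),
    (hm.comp (hg.norm_sq ℝ)).smul hg, hc, ?_⟩
  intro y hy
  have hgy : 0 < ‖gradient ρ y‖ := norm_pos_iff.2 (hν y hy).1
  have hm1 : m (‖gradient ρ y‖ ^ 2) = ‖gradient ρ y‖⁻¹ := by
    rw [hms _ (pow_le_pow_left₀ hc.le (hcK y hy) 2), Real.sqrt_sq hgy.le]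
  simp only [hm1]
  refine ⟨(hν y hy).2, ?_, ?_⟩
  · rw [norm_smul, norm_inv, norm_norm, inv_mul_cancel₀ hgy.ne']
  · rw [← inner_gradient_left, real_inner_smul_right, real_inner_self_eq_norm_sq, sq, ← mul_assoc,
      inv_mul_cancel₀ hgy.ne', one_mul]
    exact hcK y hy

end

/-! ### Bounds for the field φN -/

section

open Filter Topology

variable {n : ℕ}

theorem IsBoundedCDomain.isCompact_closure {m : ℕ} {Ω : Set (EuclideanSpace ℝ (Fin n))}
    (hΩ : IsBoundedCDomain m Ω) :
    IsCompact (closure Ω) :=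
  hΩ.isBounded.isCompact_closure

theorem IsBoundedCDomain.uniqueDiffOn_dataSet {Ω : Set (EuclideanSpace ℝ (Fin n))}
    (hΩ : IsBoundedCDomain 3 Ω) {M : ℝ}
    (hM : 0 < M) : UniqueDiffOn ℝ (dataSet Ω M) :=
  hΩ.uniqueDiffOn_closure.prod (uniqueDiffOn_Icc (by linarith))

/-- Ω × [-M, M] is relatively open in the data set, so derivatives within either set agree there. -/
theorem iteratedFDerivWithin_prod_Icc_eq {F : Type*} [NormedAddCommGroup F] [NormedSpace ℝ F]
    {Ω : Set (EuclideanSpace ℝ (Fin n))} (hΩ : IsOpen Ω) {M : ℝ}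
    (g : EuclideanSpace ℝ (Fin n) × ℝ → F) (j : ℕ) {p : EuclideanSpace ℝ (Fin n) × ℝ}
    (hp : p ∈ Ω ×ˢ Set.Icc (-M) M) :
    iteratedFDerivWithin ℝ j g (Ω ×ˢ Set.Icc (-M) M) p =
      iteratedFDerivWithin ℝ j g (dataSet Ω M) p := by
  have h : Ω ×ˢ Set.Icc (-M) M = dataSet Ω M ∩ Ω ×ˢ Set.univ := by
    ext q
    simp only [dataSet, Set.mem_prod, Set.mem_inter_iff, Set.mem_univ, and_true]
    exact ⟨fun h => ⟨⟨subset_closure h.1, h.2⟩, h.1⟩, fun h => ⟨h.2, h.1.2⟩⟩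
  rw [h]
  exact iteratedFDerivWithin_inter_open (hΩ.prod isOpen_univ) ⟨hp.1, trivial⟩

/-- Bounds for the vector field `φ(x, z) N(x)` and its derivatives of order at most two. -/
theorem IsBoundedCDomain.exists_smul_field_bound {Ω : Set (EuclideanSpace ℝ (Fin n))}
    (hΩ : IsBoundedCDomain 3 Ω)
    {M L : ℝ} (hM : 0 < M) (hL : 0 ≤ L) {N : EuclideanSpace ℝ (Fin n) → EuclideanSpace ℝ (Fin n)}
    (hN : ContDiff ℝ 2 N) :
    ∃ B : ℝ, 0 ≤ B ∧ ∀ φ : EuclideanSpace ℝ (Fin n) × ℝ → ℝ, IsC3BoundedBy Ω M L φ →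
      ContDiffOn ℝ 2 (fun p => φ p • N p.1) (Ω ×ˢ Set.Icc (-M) M) ∧
      ∀ p ∈ Ω ×ˢ Set.Icc (-M) M, ‖φ p • N p.1‖ ≤ B ∧
        ‖fderivWithin ℝ (fun p => φ p • N p.1) (Ω ×ˢ Set.Icc (-M) M) p‖ ≤ B ∧
        ‖fderivWithin ℝ (fderivWithin ℝ (fun p => φ p • N p.1) (Ω ×ˢ Set.Icc (-M) M))
          (Ω ×ˢ Set.Icc (-M) M) p‖ ≤ B := by
  have hD : IsCompact (dataSet Ω M) := hΩ.isCompact_closure.prod isCompact_Icc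
  have hDu := hΩ.uniqueDiffOn_dataSet hM
  have hSu : UniqueDiffOn ℝ (Ω ×ˢ Set.Icc (-M) M) :=
    hΩ.isOpen.uniqueDiffOn.prod (uniqueDiffOn_Icc (by linarith))
  have hG : ContDiff ℝ 2 fun p : EuclideanSpace ℝ (Fin n) × ℝ => N p.1 := hN.comp contDiff_fst
  have hb : ∀ j : ℕ, ∃ b : ℝ, j ≤ 2 → ∀ p ∈ dataSet Ω M,
      ‖iteratedFDeriv ℝ j (fun p : EuclideanSpace ℝ (Fin n) × ℝ => N p.1) p‖ ≤ b := by
    intro j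
    by_cases hj : j ≤ 2
    · obtain ⟨b, hb⟩ := hD.exists_bound_of_continuousOn
        (hG.continuous_iteratedFDeriv (m := j) (by exact_mod_cast hj)).continuousOn
      exact ⟨b, fun _ => hb⟩
    · exact ⟨0, fun h => absurd h hj⟩
  choose b hb using hb
  set β : ℝ := |b 0| + |b 1| + |b 2| with hβ
  have hbβ : ∀ j ≤ 2, ∀ p ∈ dataSet Ω M,
      ‖iteratedFDerivWithin ℝ j (fun p : EuclideanSpace ℝ (Fin n) × ℝ => N p.1) (dataSet Ω M) p‖ ≤
        β := by
    intro j hj p hp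
    rw [iteratedFDerivWithin_eq_iteratedFDeriv hDu
      (hG.contDiffAt.of_le (by exact_mod_cast hj)) hp]
    refine (hb j hj p hp).trans ((le_abs_self _).trans ?_)
    rw [hβ]
    have h0 := abs_nonneg (b 0)
    have h1 := abs_nonneg (b 1)
    have h2 := abs_nonneg (b 2)
    interval_cases j <;> linarith
  have hβ0 : 0 ≤ β := by positivity
  -- The Leibniz rule of order j ≤ 2 has binomial sum 2^j ≤ 4.
  refine ⟨4 * (L * β), by positivity, fun φ hφ => ?_⟩
  have hφ2 : ContDiffOn ℝ 2 φ (dataSet Ω M) := hφ.contDiffOn.of_le (by norm_num)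
  have hΨ : ContDiffOn ℝ 2 (fun p => φ p • N p.1) (Ω ×ˢ Set.Icc (-M) M) :=
    (hφ2.smul hG.contDiffOn).mono prod_Icc_subset_dataSet
  have hmain : ∀ j ≤ 2, ∀ p ∈ Ω ×ˢ Set.Icc (-M) M,
      ‖iteratedFDerivWithin ℝ j (fun p => φ p • N p.1) (Ω ×ˢ Set.Icc (-M) M) p‖
        ≤ 4 * (L * β) := by
    intro j hj p hp
    have hp' := prod_Icc_subset_dataSet hp
    rw [iteratedFDerivWithin_prod_Icc_eq hΩ.isOpen _ _ hp]
    refine (norm_iteratedFDerivWithin_smul_le (n := j) (N := 2) hφ2 hG.contDiffOn hDu hp'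
      (by exact_mod_cast hj)).trans ?_
    have h1 : ∀ i ∈ Finset.range (j + 1), (j.choose i : ℝ) *
        ‖iteratedFDerivWithin ℝ i φ (dataSet Ω M) p‖ *
        ‖iteratedFDerivWithin ℝ (j - i) (fun p : EuclideanSpace ℝ (Fin n) × ℝ => N p.1)
          (dataSet Ω M) p‖ ≤
        (j.choose i : ℝ) * (L * β) := by
      intro i hi
      have hij := Finset.mem_range_succ_iff.1 hi
      rw [mul_assoc]
      gcongr
      · exact hφ.bound i (by omega) p hp'
      · exact hbβ (j - i) (by omega) p hp'
    refine (Finset.sum_le_sum h1).trans ?_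
    rw [← Finset.sum_mul, ← Nat.cast_sum, Nat.sum_range_choose]
    gcongr
    have : 2 ^ j ≤ 2 ^ 2 := Nat.pow_le_pow_right (by norm_num) hj
    exact_mod_cast this
  refine ⟨hΨ, fun p hp => ⟨?_, ?_, ?_⟩⟩
  · rw [← norm_iteratedFDerivWithin_zero (𝕜 := ℝ)
    (f := fun p : EuclideanSpace ℝ (Fin n) × ℝ => φ p • N p.1)
      (s := Ω ×ˢ Set.Icc (-M) M)]
    exact hmain 0 (by norm_num) p hp
  · rw [← norm_iteratedFDerivWithin_one _ (hSu p hp)]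
    exact hmain 1 (by norm_num) p hp
  · rw [← norm_iteratedFDerivWithin_one _ (hSu p hp),
      norm_iteratedFDerivWithin_fderivWithin hSu hp]
    exact hmain 2 le_rfl p hp

end

/-! ### The boundary maximum -/

section

open Filter Topology

variable {n : ℕ} {Ω : Set (EuclideanSpace ℝ (Fin n))} {M L : ℝ}
  {φ : EuclideanSpace ℝ (Fin n) × ℝ → ℝ} {u : EuclideanSpace ℝ (Fin n) → ℝ}
    {N : EuclideanSpace ℝ (Fin n) → EuclideanSpace ℝ (Fin n)} {x : EuclideanSpace ℝ (Fin n)}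

theorem IsC3BoundedBy.norm_fderivWithin_le (hφ : IsC3BoundedBy Ω M L φ)
    (hΩ : IsBoundedCDomain 3 Ω) (hM : 0 < M) {p : EuclideanSpace ℝ (Fin n) × ℝ}
    (hp : p ∈ dataSet Ω M) :
    ‖fderivWithin ℝ φ (dataSet Ω M) p‖ ≤ L := by
  rw [← norm_iteratedFDerivWithin_one _ (hΩ.uniqueDiffOn_dataSet hM p hp)]
  exact hφ.bound 1 (by norm_num) p hp

theorem IsC3BoundedBy.abs_apply_le (hφ : IsC3BoundedBy Ω M L φ) {p : EuclideanSpace ℝ (Fin n) × ℝ}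
    (hp : p ∈ dataSet Ω M) :
    |φ p| ≤ L := by
  rw [← Real.norm_eq_abs, ← norm_iteratedFDerivWithin_zero (𝕜 := ℝ) (f := φ) (s := dataSet Ω M)]
  exact hφ.bound 0 (by norm_num) p hp

theorem IsC3BoundedBy.hasFDerivWithinAt_comp (hφ : IsC3BoundedBy Ω M L φ)
    (hu : ContDiffOn ℝ 2 u (closure Ω)) (huM : ∀ y ∈ closure Ω, |u y| ≤ M)
    (hx : x ∈ closure Ω) :
    HasFDerivWithinAt (fun y => φ (y, u y))
      ((fderivWithin ℝ φ (dataSet Ω M) (x, u x)).comp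
        ((ContinuousLinearMap.id ℝ (EuclideanSpace ℝ (Fin n))).prod (fderivWithin ℝ u (closure Ω) x))) (closure Ω) x := by
  have hmaps : ∀ y ∈ closure Ω, (y, u y) ∈ dataSet Ω M := fun y hy => ⟨hy, abs_le.1 (huM y hy)⟩
  have h1 := (hφ.contDiffOn.differentiableOn (by norm_num) _ (hmaps x hx)).hasFDerivWithinAt
  have h2 := (hu.differentiableOn (by norm_num) x hx).hasFDerivWithinAt
  exact h1.comp (f := fun y => (y, u y)) x ((hasFDerivWithinAt_id x _).prodMk h2) hmaps

theorem ContDiffOn.hasFDerivWithinAt_fderivWithin_closure (hΩ : IsBoundedCDomain 3 Ω)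
    (hu : ContDiffOn ℝ 2 u (closure Ω)) (hx : x ∈ closure Ω) :
    HasFDerivWithinAt (fderivWithin ℝ u (closure Ω))
      (fderivWithin ℝ (fderivWithin ℝ u (closure Ω)) (closure Ω) x) (closure Ω) x :=
  ((hu.fderivWithin hΩ.uniqueDiffOn_closure (m := 1) (by norm_num)).differentiableOn
    (by norm_num) x hx).hasFDerivWithinAt

/-- Differentiating the Neumann condition along the boundary. -/
theorem IsNeumannSolution.tangential_derivative {k : ℕ} {f : EuclideanSpace ℝ (Fin n) × ℝ → ℝ}
    (hu : IsNeumannSolution k Ω f φ u) (hΩ : IsBoundedCDomain 3 Ω)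
    (hφ : IsC3BoundedBy Ω M L φ) (huM : ∀ y ∈ closure Ω, |u y| ≤ M) (hN : ContDiff ℝ 2 N)
    (hν : ∀ y ∈ frontier Ω, IsOuterUnitNormal Ω y (N y)) (hx : x ∈ frontier Ω)
    {ξ : EuclideanSpace ℝ (Fin n)}
    (hξ : inner ℝ ξ (N x) = 0) :
    fderivWithin ℝ (fderivWithin ℝ u (closure Ω)) (closure Ω) x ξ (N x) =
      fderivWithin ℝ φ (dataSet Ω M) (x, u x) (ξ, fderivWithin ℝ u (closure Ω) x ξ) -
        fderivWithin ℝ u (closure Ω) x (fderiv ℝ N x ξ) := by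
  have hxT := frontier_subset_closure hx
  obtain ⟨-, U, ρ, hρ, hNx⟩ := hν x hx
  have hρξ : fderiv ℝ ρ x ξ = 0 := by
    rw [hNx, real_inner_smul_right, real_inner_comm, inner_gradient_left] at hξ
    exact (mul_eq_zero.1 hξ).resolve_left (inv_ne_zero (norm_ne_zero_iff.2 hρ.gradient_ne_zero))
  obtain ⟨γ, hγ0, hγ, hγΩ⟩ := hρ.exists_curve hΩ.isOpen hx hρξ
  have hD := hu.contDiffOn_closure.hasFDerivWithinAt_fderivWithin_closure hΩ hxT
  have hNd : HasFDerivWithinAt N (fderiv ℝ N x) (closure Ω) x :=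
    ((hN.differentiable (by norm_num)) x).hasFDerivAt.hasFDerivWithinAt
  -- The function Du·N - φ(y,u) vanishes on the boundary, so its derivative along the boundary curve
  -- with velocity ξ is zero. Solving for D²u(ξ, N) gives the claim.
  have h1 := (hD.clm_apply hNd).sub (hφ.hasFDerivWithinAt_comp hu.contDiffOn_closure huM hxT)
  have h2 := h1.comp_hasDerivAt_of_eq 0 hγ
    (hγΩ.mono fun t ht => frontier_subset_closure ht) hγ0.symm
  have h3 : ((fun y => fderivWithin ℝ u (closure Ω) y (N y)) - fun y => φ (y, u y)) ∘ γ
      =ᶠ[𝓝 0] fun _ => 0 := by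
    filter_upwards [hγΩ] with t ht
    simp [hu.neumann _ ht _ (hν _ ht)]
  have h4 := h2.unique ((hasDerivAt_const (0:ℝ) (0:ℝ)).congr_of_eventuallyEq h3)
  simp only [_root_.sub_apply, _root_.add_apply, ContinuousLinearMap.comp_apply,
    ContinuousLinearMap.flip_apply, ContinuousLinearMap.prod_apply,
    ContinuousLinearMap.id_apply] at h4
  linarith

/-- A boundary maximum of the auxiliary function forces a bound for the modified gradient. -/
theorem IsNeumannSolution.norm_le_one_of_boundary_max {k : ℕ} {f : EuclideanSpace ℝ (Fin n) × ℝ → ℝ}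
    (hu : IsNeumannSolution k Ω f φ u) (hΩ : IsBoundedCDomain 3 Ω) (hM : 0 < M) (hL : 0 ≤ L)
    (hφ : IsC3BoundedBy Ω M L φ) (huM : ∀ y ∈ closure Ω, |u y| ≤ M) (hN : ContDiff ℝ 2 N)
    (hν : ∀ y ∈ frontier Ω, IsOuterUnitNormal Ω y (N y)) (hx : x ∈ frontier Ω)
    (hν1 : ‖N x‖ = 1) {ρ : EuclideanSpace ℝ (Fin n) → ℝ} (hρ : ContDiff ℝ 2 ρ) {α b c : ℝ}
    (hα : 0 ≤ α)
    (hc : c ≤ fderiv ℝ ρ x (N x)) (hb : ‖fderiv ℝ N x‖ ≤ b)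
    (hαc : (L + b) * (1 + L) + L + L * b + L / (2 * M) < α * c)
    (hmax : ∀ y ∈ closure Ω,
      ‖gradientWithin u (closure Ω) y - φ (y, u y) • N y‖ * Real.exp (-(α * ρ y)) /
          √(2 * M - u y) ≤
        ‖gradientWithin u (closure Ω) x - φ (x, u x) • N x‖ * Real.exp (-(α * ρ x)) /
          √(2 * M - u x)) :
    ‖gradientWithin u (closure Ω) x - φ (x, u x) • N x‖ ≤ 1 := by
  by_contra! hW
  have hxT := frontier_subset_closure hx
  have hxp : (x, u x) ∈ dataSet Ω M := ⟨hxT, abs_le.1 (huM x hxT)⟩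
  have hpos : ∀ y ∈ closure Ω, M ≤ 2 * M - u y := fun y hy => by
    linarith [(abs_le.1 (huM y hy)).2]
  set T := closure Ω with hT
  set V : EuclideanSpace ℝ (Fin n) → EuclideanSpace ℝ (Fin n) :=
      fun y => gradientWithin u T y - φ (y, u y) • N y with hV
  change 1 < ‖V x‖ at hW
  set W := ‖V x‖ with hWdef
  have hW0 : 0 < W := by linarith
  set ξ : EuclideanSpace ℝ (Fin n) := W⁻¹ • V x with hξdef
  have hVξ : V x = W • ξ := by rw [hξdef, smul_smul, mul_inv_cancel₀ hW0.ne', one_smul]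
  have hξ1 : ‖ξ‖ = 1 := by rw [hξdef, norm_smul, norm_inv, norm_norm, inv_mul_cancel₀ hW0.ne']
  set D := fderivWithin ℝ u T x with hDdef
  set Q := fderivWithin ℝ (fderivWithin ℝ u T) T x with hQdef
  set φ' := fderivWithin ℝ φ (dataSet Ω M) (x, u x) with hφ'def
  have hDν : D (N x) = φ (x, u x) := hu.neumann x hx _ (hν x hx)
  -- By the Neumann condition V·ν = u_ν - φ = 0, so ξ is tangential.
  have hξν : inner ℝ ξ (N x) = 0 := by
    rw [hξdef, real_inner_smul_left, hV]
    simp only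
    rw [inner_sub_left, inner_gradientWithin_left, real_inner_smul_left,
      real_inner_self_eq_norm_sq, hν1, ← hDdef, hDν]
    ring
  have htan : Q ξ (N x) = φ' (ξ, D ξ) - D (fderiv ℝ N x ξ) :=
    hu.tangential_derivative hΩ hφ huM hN hν hx hξν
  have hsym : Q (N x) ξ = Q ξ (N x) := by
    have h := (hu.contDiffOn_closure x hxT).isSymmSndFDerivWithinAt (by simp)
      hΩ.uniqueDiffOn_closure ?_ hxT
    · exact h (N x) ξ
    · exact closure_mono (interior_maximal subset_closure hΩ.isOpen) hxT
  have hD : HasFDerivWithinAt (fderivWithin ℝ u T) Q T x :=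
    hu.contDiffOn_closure.hasFDerivWithinAt_fderivWithin_closure hΩ hxT
  -- Over ℝ the conjugate-linear inverse Riesz map is linear; `J` repackages it so that the chain
  -- rule applies.
  obtain ⟨J, hJ⟩ : ∃ J : StrongDual ℝ (EuclideanSpace ℝ (Fin n)) →L[ℝ] (EuclideanSpace ℝ (Fin n)),
      ∀ l, J l = (InnerProductSpace.toDual ℝ (EuclideanSpace ℝ (Fin n))).symm l :=
    ⟨⟨⟨⟨(InnerProductSpace.toDual ℝ (EuclideanSpace ℝ (Fin n))).symm, map_add _⟩,
      fun c l => by simp⟩,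
      (InnerProductSpace.toDual ℝ (EuclideanSpace ℝ (Fin n))).symm.continuous⟩, fun _ => rfl⟩
  have hg : HasFDerivWithinAt (gradientWithin u T) (J.comp Q) T x := by
    have h := J.hasFDerivAt.comp_hasFDerivWithinAt x hD
    refine h.congr_of_eventuallyEq (Eventually.of_forall fun y => ?_) ?_ <;>
      simp [gradientWithin, hJ]
  have hφc := hφ.hasFDerivWithinAt_comp hu.contDiffOn_closure huM hxT
  have hNd : HasFDerivWithinAt N (fderiv ℝ N x) T x :=
    ((hN.differentiable (by norm_num)) x).hasFDerivAt.hasFDerivWithinAt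
  have hVd : HasFDerivWithinAt V _ T x := hg.sub (hφc.smul hNd)
  have hud : HasFDerivWithinAt u D T x :=
    (hu.contDiffOn_closure.differentiableOn (by norm_num) x hxT).hasFDerivWithinAt
  have hρd : HasFDerivWithinAt ρ (fderiv ℝ ρ x) T x :=
    ((hρ.differentiable (by norm_num)) x).hasFDerivAt.hasFDerivWithinAt
  have hs0 : 0 < 2 * M - u x := by linarith [hpos x hxT]
  -- Half the logarithm of |V|² replaces log|V|, since the squared norm has a derivative formula
  -- without division.
  have hF : HasFDerivWithinAt (fun y => 1 / 2 * Real.log (‖V y‖ ^ 2) - α * ρ y -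
      1 / 2 * Real.log (2 * M - u y)) _ T x :=
    (((hVd.norm_sq.log (pow_pos hW0 2).ne').const_mul (1 / 2)).sub (hρd.const_mul α)).sub
      (((hud.const_sub (2 * M)).log hs0.ne').const_mul (1 / 2))
  have hFmax : IsLocalMaxOn (fun y => 1 / 2 * Real.log (‖V y‖ ^ 2) - α * ρ y -
      1 / 2 * Real.log (2 * M - u y)) T x := by
    have hlog : ∀ y ∈ T, 0 < ‖V y‖ → 1 / 2 * Real.log (‖V y‖ ^ 2) - α * ρ y -
        1 / 2 * Real.log (2 * M - u y) =
          Real.log (‖V y‖ * Real.exp (-(α * ρ y)) / √(2 * M - u y)) := by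
      intro y hy hVy
      have h1 := hpos y hy
      have h2 : 0 < √(2 * M - u y) := Real.sqrt_pos.2 (by linarith)
      rw [Real.log_div (mul_pos hVy (Real.exp_pos _)).ne' h2.ne',
        Real.log_mul hVy.ne' (Real.exp_pos _).ne', Real.log_exp, Real.log_sqrt (by linarith),
        Real.log_pow]
      push_cast
      ring
    filter_upwards [hVd.continuousWithinAt.norm.eventually (lt_mem_nhds hW0),
      self_mem_nhdsWithin] with y hy hyT
    rw [hlog y hyT hy, hlog x hxT hW0]
    have h1 := hpos y hyT
    have h2 : 0 < √(2 * M - u y) := Real.sqrt_pos.2 (by linarith)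
    exact Real.log_le_log (by positivity) (hmax y hyT)
  -- The inward direction -ν is tangent to the closed domain, so the derivative of the test function
  -- along -ν is nonpositive at the maximum.
  have hcone : -N x ∈ posTangentConeAt T x := by
    obtain ⟨-, U, ρ', hρ', hNx⟩ := hν x hx
    have h1 : fderiv ℝ ρ' x (-N x) < 0 := by
      have hpos := norm_pos_iff.2 hρ'.gradient_ne_zero
      rw [map_neg, neg_lt_zero, ← inner_gradient_left, hNx, real_inner_smul_right,
        real_inner_self_eq_norm_sq]
      positivity
    refine mem_posTangentConeAt_of_frequently_mem (Eventually.frequently ?_)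
    exact (hρ'.eventually_mem (hρ'.eq_zero hΩ.isOpen hx) h1).mono fun t ht => subset_closure ht
  have hle := hFmax.hasFDerivWithinAt_nonpos hF hcone
  have hgQ : inner ℝ (V x) (J (Q (N x))) = W * Q ξ (N x) := by
    rw [hVξ, real_inner_smul_left, hJ, real_inner_comm, InnerProductSpace.toDual_symm_apply, hsym]
  -- Orthogonality of V and ν removes the normal derivative of φ(y,u), which multiplies N; only φ
  -- times the derivative of N remains.
  have hVν : inner ℝ (V x) (N x) = 0 := by rw [hVξ, real_inner_smul_left, hξν, mul_zero]
  have hVN : inner ℝ (V x) (fderiv ℝ N x (N x)) = W * inner ℝ ξ (fderiv ℝ N x (N x)) := by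
    rw [hVξ, real_inner_smul_left]
  simp only [map_neg, _root_.sub_apply, _root_.add_apply, _root_.smul_apply, _root_.neg_apply,
    ContinuousLinearMap.comp_apply, ContinuousLinearMap.smulRight_apply, smul_eq_mul, nsmul_eq_mul,
    innerSL_apply_apply, inner_sub_right, inner_add_right, real_inner_smul_right, hgQ, hVν, hVN,
    hDν] at hle
  have key : α * fderiv ℝ ρ x (N x) ≤
      (Q ξ (N x) - φ (x, u x) * inner ℝ ξ (fderiv ℝ N x (N x))) / W +
        φ (x, u x) / (2 * (2 * M - u x)) := by
    have e1 : (Q ξ (N x) - φ (x, u x) * inner ℝ ξ (fderiv ℝ N x (N x))) / W =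
        1 / 2 * ((W ^ 2)⁻¹ * (2 * (W * Q ξ (N x) -
          φ (x, u x) * (W * inner ℝ ξ (fderiv ℝ N x (N x)))))) := by
      field_simp
    have e2 : φ (x, u x) / (2 * (2 * M - u x)) =
        1 / 2 * ((2 * M - u x)⁻¹ * φ (x, u x)) := by
      field_simp
    rw [e1, e2]
    simp only [← hWdef, mul_zero, add_zero] at hle
    push_cast at hle
    linarith
  have hφ0 : |φ (x, u x)| ≤ L := hφ.abs_apply_le hxp
  have hb0 : 0 ≤ b := (norm_nonneg _).trans hb
  have hDle : ‖D‖ ≤ W + L := by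
    have h1 : gradientWithin u T x = V x + φ (x, u x) • N x := by simp [hV]
    have h2 : ‖D‖ = ‖gradientWithin u T x‖ := by
      rw [gradientWithin, LinearIsometryEquiv.norm_map]
    rw [h2, h1]
    refine (norm_add_le _ _).trans ?_
    rw [norm_smul, hν1, mul_one, Real.norm_eq_abs]
    linarith
  have hq : Q ξ (N x) ≤ L * (1 + ‖D‖) + ‖D‖ * b := by
    have h1 : |φ' (ξ, D ξ)| ≤ L * (1 + ‖D‖) := by
      refine (φ'.le_opNorm _).trans (mul_le_mul (hφ.norm_fderivWithin_le hΩ hM hxp) ?_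
        (norm_nonneg _) hL)
      have h2 : ‖D ξ‖ ≤ ‖D‖ := by simpa [hξ1] using D.le_opNorm ξ
      rw [Prod.norm_def, max_le_iff]
      simp only [hξ1]
      exact ⟨by linarith [norm_nonneg D], by linarith⟩
    have h2 : |D (fderiv ℝ N x ξ)| ≤ ‖D‖ * b := by
      refine (D.le_opNorm _).trans (mul_le_mul_of_nonneg_left ?_ (norm_nonneg D))
      refine le_trans ?_ hb
      simpa [hξ1] using (fderiv ℝ N x).le_opNorm ξ
    rw [htan]
    linarith [(abs_le.1 h1).2, (abs_le.1 h2).1]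
  have hi : |φ (x, u x) * inner ℝ ξ (fderiv ℝ N x (N x))| ≤ L * b := by
    rw [abs_mul]
    refine mul_le_mul hφ0 ?_ (abs_nonneg _) hL
    refine (abs_real_inner_le_norm _ _).trans ?_
    rw [hξ1, one_mul]
    refine le_trans ?_ hb
    simpa [hν1] using (fderiv ℝ N x).le_opNorm (N x)
  -- The numerator is at most linear in W, and W > 1 makes the quotient bounded by constants
  -- independent of u.
  have h1 : (Q ξ (N x) - φ (x, u x) * inner ℝ ξ (fderiv ℝ N x (N x))) / W ≤
      (L + b) * (1 + L) + L + L * b := by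
    rw [div_le_iff₀ hW0]
    have h2 : ‖D‖ * (L + b) ≤ (W + L) * (L + b) :=
      mul_le_mul_of_nonneg_right hDle (by positivity)
    have h3 : 0 ≤ (W - 1) * ((L + b) * L + L + L * b) :=
      mul_nonneg (by linarith) (by positivity)
    linarith [(abs_le.1 hi).1]
  have h2 : φ (x, u x) / (2 * (2 * M - u x)) ≤ L / (2 * M) := by
    have := hpos x hxT
    have := (le_abs_self _).trans hφ0
    gcongr
  have h3 := mul_le_mul_of_nonneg_left hc hα
  linarith

end

/-! ### The global estimate -/

section

open Filter Topology

variable {n : ℕ}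

theorem gradientWithin_closure_eq {Ω : Set (EuclideanSpace ℝ (Fin n))} (hΩ : IsOpen Ω)
    (u : EuclideanSpace ℝ (Fin n) → ℝ) {x : EuclideanSpace ℝ (Fin n)}
    (hx : x ∈ Ω) : gradientWithin u (closure Ω) x = gradient u x := by
  rw [gradientWithin, gradient, fderivWithin_closure_eq hΩ hx]

theorem log_norm_mul_exp_div_sqrt {w r s : ℝ} (hw : 0 < w) (hs : 0 < s) :
    Real.log (w * Real.exp (-r) / √s) = Real.log w - 1 / 2 * Real.log s + -r := by
  rw [Real.log_div (mul_pos hw (Real.exp_pos _)).ne' (Real.sqrt_pos.2 hs).ne',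
    Real.log_mul hw.ne' (Real.exp_pos _).ne', Real.log_exp, Real.log_sqrt hs.le]
  ring

/-- The global gradient estimate for the Neumann problem. -/
theorem IsBoundedCDomain.exists_gradient_bound {k : ℕ} (hk : 1 ≤ k) (hkn : k ≤ n)
    {Ω : Set (EuclideanSpace ℝ (Fin n))}
    (hΩ : IsBoundedCDomain 3 Ω) {M L₁ L₂ : ℝ} (hM : 0 < M) (hL₁ : 0 ≤ L₁) (hL₂ : 0 ≤ L₂) :
    ∃ C : ℝ, 0 < C ∧ ∀ (f φ : EuclideanSpace ℝ (Fin n) × ℝ → ℝ) (u : EuclideanSpace ℝ (Fin n) → ℝ),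
    IsRhsBoundedBy Ω M L₁ f →
      IsC3BoundedBy Ω M L₂ φ → IsNeumannSolution k Ω f φ u → (∀ x ∈ closure Ω, |u x| ≤ M) →
      ∀ x ∈ closure Ω, ‖fderivWithin ℝ u (closure Ω) x‖ ≤ C := by
  obtain ⟨ρ, N, c, hρ, hN, hc, hν⟩ := hΩ.exists_normal_field
  obtain ⟨B, hB, hΨ⟩ := hΩ.exists_smul_field_bound hM hL₂ hN
  obtain ⟨C₀, hC₀, hint⟩ := exists_interior_max_bound hk hkn hM hL₁ hB
  have hK := hΩ.isCompact_closure
  have hne : (closure Ω).Nonempty := hΩ.isConnected.nonempty.mono subset_closure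
  have hρ' : ContDiff ℝ 1 (fderiv ℝ ρ) := hρ.fderiv_right (m := 1) (by norm_num)
  obtain ⟨R, hR⟩ := hK.exists_bound_of_continuousOn hρ.continuous.continuousOn
  obtain ⟨r₁, hr₁⟩ := hK.exists_bound_of_continuousOn hρ'.continuous.continuousOn
  obtain ⟨r₂, hr₂⟩ := hK.exists_bound_of_continuousOn
    (hρ'.continuous_fderiv (by norm_num)).continuousOn
  obtain ⟨b₀, hb₀⟩ := hK.exists_bound_of_continuousOn hN.continuous.continuousOn
  obtain ⟨b, hb⟩ := hK.exists_bound_of_continuousOn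
    (hN.continuous_fderiv (by norm_num)).continuousOn
  obtain ⟨x₀, hx₀⟩ := hne
  have hr₁0 : 0 ≤ r₁ := (norm_nonneg _).trans (hr₁ x₀ hx₀)
  have hr₂0 : 0 ≤ r₂ := (norm_nonneg _).trans (hr₂ x₀ hx₀)
  have hb0 : 0 ≤ b := (norm_nonneg _).trans (hb x₀ hx₀)
  have hb₀0 : 0 ≤ b₀ := (norm_nonneg _).trans (hb₀ x₀ hx₀)
  -- α is chosen so that αc strictly exceeds the constants arising at a boundary maximum. It depends
  -- only on the domain, M and L₂.
  obtain ⟨α, hα, hαc⟩ : ∃ α : ℝ, 0 ≤ α ∧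
      (L₂ + b) * (1 + L₂) + L₂ + L₂ * b + L₂ / (2 * M) < α * c := by
    refine ⟨((L₂ + b) * (1 + L₂) + L₂ + L₂ * b + L₂ / (2 * M) + 1) / c, by positivity, ?_⟩
    rw [div_mul_cancel₀ _ hc.ne']
    linarith
  obtain ⟨K, hKdef⟩ : ∃ K, K = 1 + α * r₁ + α * r₂ := ⟨_, rfl⟩
  have hα1 : 0 ≤ α * r₁ := mul_nonneg hα hr₁0
  have hα2 : 0 ≤ α * r₂ := mul_nonneg hα hr₂0
  have hK1 : 1 ≤ K := by rw [hKdef]; linarith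
  -- The bound 1 + C₀K at the maximum point is transported to any other point by comparing the
  -- weights exp(-αρ) and (2M - u)^{-1/2}; then φN is added back.
  refine ⟨(1 + C₀ * K) * Real.exp (α * R) / √M * √(3 * M) / Real.exp (-(α * R)) + L₂ * b₀,
    by positivity, ?_⟩
  intro f φ u hf hφ hu huM
  obtain ⟨hΨ2, hΨB⟩ := hΨ φ hφ
  have hpos : ∀ y ∈ closure Ω, M ≤ 2 * M - u y ∧ 2 * M - u y ≤ 3 * M := fun y hy => by
    have := abs_le.1 (huM y hy)
    constructor <;> linarith
  have hmaps : ∀ y ∈ closure Ω, (y, u y) ∈ dataSet Ω M := fun y hy => ⟨hy, abs_le.1 (huM y hy)⟩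
  have huc : ContinuousOn u (closure Ω) := hu.contDiffOn_closure.continuousOn
  set V : EuclideanSpace ℝ (Fin n) → EuclideanSpace ℝ (Fin n) :=
      fun y => gradientWithin u (closure Ω) y - φ (y, u y) • N y with hV
  set H : EuclideanSpace ℝ (Fin n) → ℝ :=
      fun y => ‖V y‖ * Real.exp (-(α * ρ y)) / √(2 * M - u y) with hH
  have hVc : ContinuousOn V (closure Ω) := by
    refine ContinuousOn.sub ?_ (ContinuousOn.fun_smul ?_ hN.continuous.continuousOn)
    · exact (InnerProductSpace.toDual ℝ (EuclideanSpace ℝ (Fin n))).symm.continuous.comp_continuousOn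
        (hu.contDiffOn_closure.continuousOn_fderivWithin hΩ.uniqueDiffOn_closure (by norm_num))
    · exact hφ.contDiffOn.continuousOn.comp (continuousOn_id.prodMk huc) hmaps
  have hsqrt : ∀ y ∈ closure Ω, 0 < √(2 * M - u y) := fun y hy =>
    Real.sqrt_pos.2 (by linarith [(hpos y hy).1])
  have hHc : ContinuousOn H (closure Ω) := by
    refine ContinuousOn.div (hVc.norm.mul ?_) (continuousOn_const.sub huc).sqrt
      fun y hy => (hsqrt y hy).ne'
    exact (Real.continuous_exp.comp (continuous_const.mul hρ.continuous).neg).continuousOn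
  obtain ⟨x, hx, hmax⟩ := hK.exists_isMaxOn ⟨x₀, hx₀⟩ hHc
  have hW : ‖V x‖ ≤ 1 + C₀ * K := by
    by_cases hxΩ : x ∈ Ω
    · by_cases hVx : ‖V x‖ = 0
      · rw [hVx]; positivity
      have hVx0 : 0 < ‖V x‖ := lt_of_le_of_ne (norm_nonneg _) (Ne.symm hVx)
      have hVeq : ∀ y ∈ Ω, V y = gradient u y - φ (y, u y) • N y := fun y hy => by
        simp only [hV, gradientWithin_closure_eq hΩ.isOpen u hy]
      have h1 := hint Ω f u (fun p => φ p • N p.1) (fun y => -(α * ρ y))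
        (fun w => -(α * fderiv ℝ ρ x w)) (fun w => -(α * fderiv ℝ (fderiv ℝ ρ) x w w)) x K
        hΩ.isOpen hxΩ hu.contDiffOn hu.admissible hu.equation
        (fun y hy => huM y (subset_closure hy)) hf.differentiableOn hf.nonneg_and_le
        (hf.abs_fderivWithin_le hΩ.isOpen hM) hΨ2 hΨB ?_ ?_ ?_ hK1 ?_
      · simp only at h1
        rw [← hVeq x hxΩ] at h1
        linarith
      · intro w
        simpa using (hasDerivAtTwice_of_contDiffAt hρ.contDiffAt w).clm
          ((-α) • ContinuousLinearMap.id ℝ ℝ)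
      · intro w
        rw [abs_neg, abs_mul, abs_of_nonneg hα]
        have h2 := ((fderiv ℝ ρ x).le_opNorm w).trans
          (mul_le_mul_of_nonneg_right (hr₁ x hx) (norm_nonneg w))
        have h3 := mul_le_mul_of_nonneg_left h2 hα
        have h4 : α * r₁ * ‖w‖ ≤ K * ‖w‖ :=
          mul_le_mul_of_nonneg_right (by rw [hKdef]; linarith) (norm_nonneg w)
        rw [Real.norm_eq_abs] at h3
        linarith
      · intro w
        have h2 := ((fderiv ℝ (fderiv ℝ ρ) x).le_opNorm₂ w w).trans
          (mul_le_mul_of_nonneg_right (mul_le_mul_of_nonneg_right (hr₂ x hx) (norm_nonneg w))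
            (norm_nonneg w))
        have h3 := mul_le_mul_of_nonneg_left ((le_abs_self _).trans h2) hα
        have h4 : α * r₂ ≤ K ^ 2 := by nlinarith
        have h5 := mul_le_mul_of_nonneg_right h4 (sq_nonneg ‖w‖)
        rw [neg_le_neg_iff]
        refine h3.trans (le_trans (le_of_eq ?_) h5)
        ring
      · have hV0 : ∀ᶠ y in 𝓝 x, 0 < ‖V y‖ :=
          ((hVc.mono subset_closure).continuousAt (hΩ.isOpen.mem_nhds hxΩ)).norm.eventually
            (lt_mem_nhds hVx0)
        have hlog : ∀ y ∈ Ω, 0 < ‖V y‖ → Real.log ‖gradient u y - φ (y, u y) • N y‖ -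
            1 / 2 * Real.log (2 * M - u y) + -(α * ρ y) = Real.log (H y) := fun y hy hVy => by
          rw [← hVeq y hy, ← log_norm_mul_exp_div_sqrt hVy]
          linarith [(hpos y (subset_closure hy)).1]
        filter_upwards [hV0, hΩ.isOpen.mem_nhds hxΩ] with y hy hyΩ
        rw [hlog y hyΩ hy, hlog x hxΩ hVx0]
        have := hsqrt y (subset_closure hyΩ)
        exact Real.log_le_log (by simp only [hH]; positivity) (hmax (subset_closure hyΩ))
    · have hxf : x ∈ frontier Ω := by
        rw [hΩ.isOpen.frontier_eq]; exact ⟨hx, hxΩ⟩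
      have h1 : ‖V x‖ ≤ 1 := hu.norm_le_one_of_boundary_max hΩ hM hL₂ hφ huM hN
        (fun y hy => (hν y hy).1) hxf (hν x hxf).2.1 hρ hα (hν x hxf).2.2 (hb x hx) hαc
        fun y hy => hmax hy
      have : 0 ≤ C₀ * K := by positivity
      linarith
  intro y hy
  have h1 : ‖fderivWithin ℝ u (closure Ω) y‖ = ‖V y + φ (y, u y) • N y‖ := by
    rw [hV, sub_add_cancel, gradientWithin, LinearIsometryEquiv.norm_map]
  have h2 : ‖φ (y, u y) • N y‖ ≤ L₂ * b₀ := by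
    rw [norm_smul]
    exact mul_le_mul (hφ.abs_apply_le (hmaps y hy)) (hb₀ y hy) (norm_nonneg _) hL₂
  rw [h1]
  refine (norm_add_le _ _).trans (add_le_add ?_ h2)
  have hαR : ∀ z ∈ closure Ω, |α * ρ z| ≤ α * R := fun z hz => by
    rw [abs_mul, abs_of_nonneg hα]
    exact mul_le_mul_of_nonneg_left (hR z hz) hα
  have h3 : H x ≤ (1 + C₀ * K) * Real.exp (α * R) / √M := by
    have h4 : -(α * ρ x) ≤ α * R := by linarith [(abs_le.1 (hαR x hx)).1]
    have h5 := (hpos x hx).1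
    simp only [hH]
    gcongr
  have h4 : ‖V y‖ * Real.exp (-(α * R)) / √(3 * M) ≤ H y := by
    have h4 : -(α * R) ≤ -(α * ρ y) := by linarith [(abs_le.1 (hαR y hy)).2]
    have h5 := (hpos y hy).2
    have h6 := hsqrt y hy
    simp only [hH]
    gcongr
  have h5 := h4.trans ((hmax hy : H y ≤ H x).trans h3)
  rw [div_le_iff₀ (by positivity)] at h5
  rwa [le_div_iff₀ (Real.exp_pos _)]

end

/-! ### Assembling the two bounds -/

section

open Filter Topology

variable {n : ℕ}

/-- The ball is connected, meets Ω and contains no boundary point, so it cannot leave Ω. -/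
theorem ball_subset_of_le_boundaryDist {Ω : Set (EuclideanSpace ℝ (Fin n))}
    {x : EuclideanSpace ℝ (Fin n)} {μ : ℝ} (hμ : 0 < μ)
    (hΩ : IsOpen Ω) (hx : x ∈ Ω) (h : μ ≤ boundaryDist Ω x) : Metric.ball x μ ⊆ Ω := by
  refine (convex_ball x μ).isPreconnected.subset_of_closure_inter_subset hΩ
    ⟨x, Metric.mem_ball_self hμ, hx⟩ fun z ⟨hz, hzb⟩ => ?_
  by_contra hzΩ
  have hzf : z ∈ frontier Ω := by
    rw [hΩ.frontier_eq]; exact ⟨hz, hzΩ⟩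
  have h1 : boundaryDist Ω x ≤ dist x z := Metric.infDist_le_dist_of_mem hzf
  rw [Metric.mem_ball, dist_comm] at hzb
  linarith

theorem hessian_eq_zero_of_eventuallyEq {u : EuclideanSpace ℝ (Fin n) → ℝ}
    {x : EuclideanSpace ℝ (Fin n)} (h : u =ᶠ[𝓝 x] fun _ => 0) :
    hessian u x = 0 := by
  have h1 : fderiv ℝ u =ᶠ[𝓝 x] fun _ => 0 := by
    filter_upwards [eventually_eventually_nhds.2 h] with y hy
    rw [EventuallyEq.fderiv_eq hy, fderiv_const_apply]
  ext i j
  simp only [hessian, Matrix.of_apply, Matrix.zero_apply]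
  rw [h1.fderiv_eq, fderiv_const_apply]
  simp

theorem matrixEigenvalues_zero_notMem_gardingCone {k : ℕ} (hk : 1 ≤ k) :
    matrixEigenvalues (0 : Matrix (Fin n) (Fin n) ℝ) ∉ gardingCone k := by
  intro h
  have h1 := h 1 le_rfl hk
  simp [matrixEigenvalues, Multiset.esymm, Multiset.powersetCard_one,
    Multiset.sum_nsmul] at h1

/-- Otherwise u vanishes on Ω, and the zero Hessian has σ_1 = 0, which excludes it from Γ_k. -/
theorem IsNeumannSolution.bound_pos {k : ℕ} (hk : 1 ≤ k) {Ω : Set (EuclideanSpace ℝ (Fin n))}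
    {f φ : EuclideanSpace ℝ (Fin n) × ℝ → ℝ}
    {u : EuclideanSpace ℝ (Fin n) → ℝ} (hu : IsNeumannSolution k Ω f φ u)
    (hΩ : IsBoundedCDomain 3 Ω) {M : ℝ}
    (huM : ∀ x ∈ closure Ω, |u x| ≤ M) : 0 < M := by
  by_contra! hM
  obtain ⟨x, hx⟩ := hΩ.isConnected.nonempty
  have h : u =ᶠ[𝓝 x] fun _ => 0 := by
    filter_upwards [hΩ.isOpen.mem_nhds hx] with y hy
    exact abs_nonpos_iff.1 ((huM y (subset_closure hy)).trans hM)
  have h1 := hu.admissible x hx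
  rw [hessian_eq_zero_of_eventuallyEq h] at h1
  exact matrixEigenvalues_zero_notMem_gardingCone hk h1

end

theorem theorem3p4 (n k : ℕ) (hk : 1 ≤ k) (hkn : k ≤ n) :
    ∃ M₁ : ℝ → ℝ → ℝ → ℝ, (∀ μ M₀ L₁ : ℝ, 0 < M₁ μ M₀ L₁) ∧
      ∀ Ω : Set (EuclideanSpace ℝ (Fin n)), IsBoundedCDomain 3 Ω →
      ∀ M₀ L₁ L₂ : ℝ, 0 < L₁ → 0 < L₂ →
      ∃ μ₀ : ℝ, 0 < μ₀ ∧ ∃ M₂ : ℝ, 0 < M₂ ∧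
        ∀ (f φ : EuclideanSpace ℝ (Fin n) × ℝ → ℝ) (u : EuclideanSpace ℝ (Fin n) → ℝ),
          IsRhsBoundedBy Ω M₀ L₁ f → IsC3BoundedBy Ω M₀ L₂ φ →
          IsNeumannSolution k Ω f φ u → (∀ x ∈ closure Ω, |u x| ≤ M₀) →
            (∀ μ : ℝ, 0 < μ → ∀ x ∈ Ω, μ ≤ boundaryDist Ω x →
              ‖fderivWithin ℝ u (closure Ω) x‖ ≤ M₁ μ M₀ L₁) ∧
            ∀ x ∈ closure (boundaryStrip Ω μ₀),
              ‖fderivWithin ℝ u (closure Ω) x‖ ≤ max (M₁ μ₀ M₀ L₁) M₂ := by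
  have hint : ∀ μ M L : ℝ, ∃ C : ℝ, 0 < C ∧ (0 < μ → 0 < M → 0 < L →
      ∀ (Ω : Set (EuclideanSpace ℝ (Fin n))) (f : EuclideanSpace ℝ (Fin n) × ℝ → ℝ)
        (u : EuclideanSpace ℝ (Fin n) → ℝ) (x : EuclideanSpace ℝ (Fin n)), IsOpen Ω →
      IsRhsBoundedBy Ω M L f → ContDiffOn ℝ 3 u Ω → IsKAdmissible k Ω u →
      (∀ y ∈ Ω, sigmaK k (hessian u y) = f (y, u y)) → (∀ y ∈ Ω, |u y| ≤ M) →
      Metric.ball x μ ⊆ Ω → ‖fderiv ℝ u x‖ ≤ C) := by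
    intro μ M L
    by_cases h : 0 < μ ∧ 0 < M ∧ 0 < L
    · obtain ⟨C, hC, hb⟩ := exists_interior_gradient_bound hk hkn h.1 h.2.1 h.2.2.le
      exact ⟨C, hC, fun _ _ _ => hb⟩
    -- A default value: M₁ must be positive for all real parameters, including those for which no
    -- estimate is claimed.
    · exact ⟨1, one_pos, fun h1 h2 h3 => absurd ⟨h1, h2, h3⟩ h⟩
  choose M₁ hM₁ hb using hint
  -- Any positive width serves as μ₀, since M₂ bounds the gradient on the whole closed domain.
  refine ⟨M₁, hM₁, fun Ω hΩ M₀ L₁ L₂ hL₁ hL₂ => ⟨1, one_pos, ?_⟩⟩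
  by_cases hM : 0 < M₀
  · obtain ⟨M₂, hM₂, hglobal⟩ := hΩ.exists_gradient_bound hk hkn hM hL₁.le hL₂.le
    refine ⟨M₂, hM₂, fun f φ u hf hφ hu huM => ⟨fun μ hμ x hx hd => ?_, fun x hx => ?_⟩⟩
    · rw [fderivWithin_closure_eq hΩ.isOpen hx]
      exact hb μ M₀ L₁ hμ hM hL₁ Ω f u x hΩ.isOpen hf hu.contDiffOn hu.admissible hu.equation
        (fun y hy => huM y (subset_closure hy)) (ball_subset_of_le_boundaryDist hμ hΩ.isOpen hx hd)
    · exact (hglobal f φ u hf hφ hu huM x (closure_mono (Set.sep_subset _ _) hx)).trans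
        (le_max_right _ _)
  · exact ⟨1, one_pos, fun f φ u _ _ hu huM => absurd (hu.bound_pos hk hΩ huM) hM⟩
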